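/- Let $\alpha>-1/2$, let $d\mu_\alpha(x)=\frac{x^{2\alpha+1}}{2^\alpha\Gamma(\alpha+1)}\,dx$ on $[0,\infty)$ and $d\nu_\alpha(a,x)=a^{2\alpha+1}\,da\,d\mu_\alpha(x)$ on $\mathbb U=(0,\infty)\times[0,\infty)$; write $\|\cdot\|_{p,\mu_\alpha}$ and $\|\cdot\|_{p,\nu_\alpha}$ for the norms of the corresponding $L^p$ spaces of complex-valued functions, with value $+\infty$ for a measurable function outside the space. Let $$j_\alpha(x)=\Gamma(\alpha+1)\sum_{n\ge0}\frac{(-1)^n}{n!\,\Gamma(n+\alpha+1)}\Big(\frac x2\Big)^{2n},\qquad \mathcal H_\alpha(g)(\xi)=\int_0^\infty g(x)\,j_\alpha(x\xi)\,d\mu_\alpha(x),$$ $$\tau^\alpha_x g(y)=\frac{\Gamma(\alpha+1)}{\Gamma(\frac12)\Gamma(\alpha+\frac12)}\int_0^\pi g\big(\sqrt{x^2+y^2+2xy\cos\theta}\big)(\sin\theta)^{2\alpha}\,d\theta,\qquad \mathcal D_a g(x)=a^{\alpha+1}g(ax).$$ A nonzero $\psi\in L^1(\mu_\alpha)\cap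 L^\infty(\mu_\alpha)$ is called admissible if $0<c_\psi:=\int_0^\infty|\mathcal H_\alpha(\psi)(a)|^2\,\frac{da}{a}<\infty$, and its Hankel wavelet transform of $f\in L^2(\mu_\alpha)$ is $$\mathcal W_\psi f(a,x)=c_\psi^{-1/2}\int_0^\infty f(t)\,\overline{\tau_x^\alpha(\mathcal D_a\psi)(t)}\,d\mu_\alpha(t),\qquad (a,x)\in\mathbb U.$$ **Corollary.** Let $s,\beta>0$ and let $\psi$ be admissible with $\|\psi\|_{2,\mu_\alpha}^2\le c_\psi$. Then the constant $$C_{s,\alpha,\beta}=\frac{(\alpha+1)(s+\beta)}{s\beta}\exp\left[-1+\frac{s\beta}{(\alpha+1)(s+\beta)}\ln\left(\frac{2^{\alpha+2}\,s\beta\,\Gamma(\alpha+1)}{\Gamma(\frac{\alpha+1}{s})\,\Gamma(\frac{\alpha+1}{\beta})}\cdot\frac{c_\psi}{\|\psi\|_{2,\mu_\alpha}^2}\right)\right]$$ is positive, and for every nonzero $f\in L^2(\mu_\alpha)$, $$\|a^s\,\mathcal W_\psi f\|_{2,\nu_\alpha}^2+\|x^\beta\,\mathcal W_\psi f\|_{2,\nu_\alpha}^2\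 \ge\ C_{s,\alpha,\beta}\,\|f\|_{2,\mu_\alpha}^2 .$$ -/

import Mathlib

noncomputable section

namespace HankelWavelet

open MeasureTheory Set

/-- The weight measure `dμ_α(x) = x^(2α+1) / (2^α Γ(α+1)) dx` on `[0,∞)`, as a measure on `ℝ`
concentrated on the half-line (the endpoint `0` is a null set). -/
def mu (α : ℝ) : Measure ℝ :=
  (volume.restrict (Ioi (0 : ℝ))).withDensity
    (fun x => ENNReal.ofReal (x ^ (2 * α + 1) / (2 ^ α * Real.Gamma (α + 1))))

/-- The measure `dν_α(a,x) = a^(2α+1) da dμ_α(x)` on `(0,∞) × [0,∞)`, first coordinate `a`. -/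
def nu (α : ℝ) : Measure (ℝ × ℝ) :=
  ((volume.restrict (Ioi (0 : ℝ))).withDensity
    (fun a => ENNReal.ofReal (a ^ (2 * α + 1)))).prod (mu α)

/-- The spherical Bessel function
`j_α(x) = Γ(α+1) ∑ₙ (-1)ⁿ / (n! Γ(n+α+1)) (x/2)^(2n)`. -/
def sphericalBessel (α x : ℝ) : ℝ :=
  Real.Gamma (α + 1) *
    ∑' n : ℕ, (-1) ^ n / ((n.factorial : ℝ) * Real.Gamma (n + α + 1)) * (x / 2) ^ (2 * n)

/-- The Hankel transform `H_α(f)(ξ) = ∫ f(x) j_α(xξ) dμ_α(x)` (for `f` in `L¹(μ_α)`). -/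
def hankel (α : ℝ) (f : ℝ → ℂ) (ξ : ℝ) : ℂ :=
  ∫ x, f x * (sphericalBessel α (x * ξ) : ℂ) ∂(mu α)

/-- The Hankel translation `τ_x^α f (y)`. -/
def translation (α x : ℝ) (f : ℝ → ℂ) (y : ℝ) : ℂ :=
  ((Real.Gamma (α + 1) / (Real.Gamma (1 / 2) * Real.Gamma (α + 1 / 2)) : ℝ) : ℂ) *
    ∫ θ in (0 : ℝ)..Real.pi,
      f (√(x ^ 2 + y ^ 2 + 2 * x * y * Real.cos θ)) * ((Real.sin θ ^ (2 * α) : ℝ) : ℂ)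

/-- The dilation `D_a f(x) = a^(α+1) f(ax)`. -/
def dilation (α a : ℝ) (f : ℝ → ℂ) (x : ℝ) : ℂ :=
  ((a ^ (α + 1) : ℝ) : ℂ) * f (a * x)

/-- The admissibility constant `c_ψ = ∫₀^∞ |H_α(ψ)(a)|² da/a`, as an element of `[0,∞]`. -/
def admConst (α : ℝ) (ψ : ℝ → ℂ) : ENNReal :=
  ∫⁻ a in Ioi (0 : ℝ), ‖hankel α ψ a‖ₑ ^ 2 * ENNReal.ofReal (1 / a)

/-- `ψ` is an admissible wavelet: a nonzero element of `L¹(μ_α) ∩ L^∞(μ_α)` with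
`0 < c_ψ < ∞`. -/
structure IsAdmissible (α : ℝ) (ψ : ℝ → ℂ) : Prop where
  memLp_one : MemLp ψ 1 (mu α)
  memLp_top : MemLp ψ ⊤ (mu α)
  nonzero : ¬ (ψ =ᵐ[mu α] 0)
  admConst_pos : 0 < admConst α ψ
  admConst_lt_top : admConst α ψ < ⊤

/-- The wavelet atom `ψ_{a,x} = c_ψ^(-1/2) τ_x^α (D_a ψ)`. -/
def atom (α : ℝ) (ψ : ℝ → ℂ) (a x : ℝ) (t : ℝ) : ℂ :=
  (((admConst α ψ).toReal ^ (-(1 / 2) : ℝ) : ℝ) : ℂ) * translation α x (dilation α a ψ) t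

/-- The Hankel wavelet transform `W_ψ f(a,x) = ∫ f(t) conj(ψ_{a,x}(t)) dμ_α(t)`. -/
def transform (α : ℝ) (ψ f : ℝ → ℂ) (p : ℝ × ℝ) : ℂ :=
  ∫ t, f t * starRingEnd ℂ (atom α ψ p.1 p.2 t) ∂(mu α)

/-- The constant `C_{s,α,β}`; it also depends on `ψ`, through `c_ψ / ‖ψ‖²`. -/
def heisConst (s α β : ℝ) (ψ : ℝ → ℂ) : ℝ :=
  (α + 1) * (s + β) / (s * β) *
    Real.exp (-1 + s * β / ((α + 1) * (s + β)) *
      Real.log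
        (2 ^ (α + 2) * s * β * Real.Gamma (α + 1) /
            (Real.Gamma ((α + 1) / s) * Real.Gamma ((α + 1) / β)) *
          ((admConst α ψ).toReal / (eLpNorm ψ 2 (mu α)).toReal ^ 2)))

end HankelWavelet

end

/-!
The lower bound is an entropy argument for the density `|W_ψ f|²` on the time-scale half-plane; it
needs two facts about the wavelet transform.

* `W_ψ` does not decrease the norm: `‖f‖ ≤ ‖W_ψ f‖` in `L²(nu α)` (`eLpNorm_le_eLpNorm_transform`).
* `|W_ψ f|² ≤ M ‖f‖²` pointwise, with `M = ‖ψ‖² / c_ψ` (`enorm_transform_le`).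

Given these, put `φ(a, x) = a^(2s) + x^(2β)` and `κ = (α+1)(s+β)/(sβ)`. For `0 ≤ w ≤ M N` the
inequality `1 + v ≤ exp v` with `v = κ - φ/t` gives `(1 + κ) w ≤ w φ/t + N M exp (κ - φ/t)`
(`gibbs_pointwise`). Take `w = |W_ψ f|²`, `N = ‖f‖²` and integrate. The partition function
`∫ exp (-φ/t) dν` is an explicit multiple of `t^κ` (`lintegral_nu_exp`), and the temperature `t` for
which `∫ M exp (κ - φ/t) dν = 1` is `t = C/κ`, with `C` the constant of the theorem. What is left is
`(1 + κ) N ≤ t⁻¹ ∫ φ |W_ψ f|² dν + N` (`le_lintegral_weight_of_bound`).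

The isometry property rests on harmonic analysis for the Hankel transform.

* In polar coordinates, `mu α` times the angular probability measure is `v^(2α) du dv` on the upper
  half-plane (`lintegral_polar`), and Hankel translation by `x` averages `f(|w + x e₁|)`. Invariance
  of `v^(2α) du dv` under `u ↦ u - x` and `u ↦ -u` makes translation symmetric
  (`lintegral_triSide_swap`, `integral_translation_mul`), hence by Jensen an `L²`-contraction
  (`eLpNorm_translation_le`), which gives the pointwise bound.
* The product formula `τ_x (j_α(ξ ·))(y) = j_α(ξx) j_α(ξy)` (`integral_sphericalBessel_triSide`)
  follows from the power series by computing the angular averages of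
  `(x² + y² + 2xy cos θ)^n`; the coefficients match by a Chu–Vandermonde identity.
* Plancherel (`lintegral_hankel_sq`): the Gaussian-damped energy of the transform of `g` is the
  pairing of `g` with its average against the heat kernel, and the damping is removed in the limit.
* The transform turns `W_ψ f(a, ·)`, a generalised convolution, into a product
  (`hankel_convolution`). Plancherel in `x` and Tonelli in `a` leave the admissibility integral,
  which cancels `c_ψ` (`lintegral_transform_sq`). This is done for continuous `f` with compact
  support; the upper bound passes to `L²` by Fatou, and then the lower bound by approximation.
-/

noncomputable section

namespace HankelWavelet

open MeasureTheory Set Filter Topology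
open scoped ENNReal

/-! ### The angular measure and the polar-coordinate duality -/

/-- The probability measure on `(0, π)` proportional to `(sin θ) ^ (2α) dθ`, against which the
Hankel translation averages. -/
def angleMeasure (α : ℝ) : Measure ℝ :=
  (volume.restrict (Ioo (0 : ℝ) Real.pi)).withDensity
    (fun θ => ENNReal.ofReal (Real.Gamma (α + 1) /
      (Real.Gamma (1 / 2) * Real.Gamma (α + 1 / 2)) * Real.sin θ ^ (2 * α)))

/-- The length of the sum of two plane vectors of lengths `x` and `y` at angle `θ`. -/
def triSide (x y θ : ℝ) : ℝ := √(x ^ 2 + y ^ 2 + 2 * x * y * Real.cos θ)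

lemma triSide_comm (x y θ : ℝ) : triSide x y θ = triSide y x θ := by
  unfold triSide; congr 1; ring

@[fun_prop]
lemma continuous_triSide : Continuous fun p : ℝ × ℝ × ℝ => triSide p.1 p.2.1 p.2.2 := by
  unfold triSide; fun_prop

lemma measurable_triSide {X : Type*} [MeasurableSpace X] {f g h : X → ℝ} (hf : Measurable f)
    (hg : Measurable g) (hh : Measurable h) : Measurable fun p => triSide (f p) (g p) (h p) :=
  continuous_triSide.measurable.comp (hf.prodMk (hg.prodMk hh))

lemma triSide_sq (x y θ : ℝ) :
    triSide x y θ ^ 2 = x ^ 2 + y ^ 2 + 2 * x * y * Real.cos θ := by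
  unfold triSide
  rw [Real.sq_sqrt]
  nlinarith [sq_nonneg (x + y * Real.cos θ), Real.sin_sq_add_cos_sq θ,
    mul_nonneg (sq_nonneg y) (sq_nonneg (Real.sin θ))]

lemma triSide_zero_right {x : ℝ} (hx : 0 ≤ x) (θ : ℝ) : triSide x 0 θ = x := by
  simp [triSide, Real.sqrt_sq hx]

/-- The constant `2^α Γ(α+1)` normalising `mu α`. -/
lemma norm_const_pos {α : ℝ} (hα : -(1 / 2) < α) : 0 < 2 ^ α * Real.Gamma (α + 1) :=
  mul_pos (by positivity) (Real.Gamma_pos_of_pos (by linarith))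

lemma angle_const_pos {α : ℝ} (hα : -(1 / 2) < α) :
    0 < Real.Gamma (α + 1) / (Real.Gamma (1 / 2) * Real.Gamma (α + 1 / 2)) :=
  div_pos (Real.Gamma_pos_of_pos (by linarith))
    (mul_pos (Real.Gamma_pos_of_pos (by norm_num)) (Real.Gamma_pos_of_pos (by linarith)))

instance (α : ℝ) : SFinite (mu α) := by unfold mu; infer_instance

instance (α : ℝ) : SFinite (angleMeasure α) := by unfold angleMeasure; infer_instance

lemma ae_mu_pos (α : ℝ) : ∀ᵐ x ∂(mu α), 0 < x :=
  (withDensity_absolutelyContinuous _ _).ae_le (ae_restrict_mem measurableSet_Ioi)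

lemma lintegral_mu (α : ℝ) (F : ℝ → ℝ≥0∞) :
    ∫⁻ x, F x ∂(mu α) = ∫⁻ x in Ioi (0 : ℝ),
      ENNReal.ofReal (x ^ (2 * α + 1) / (2 ^ α * Real.Gamma (α + 1))) * F x := by
  unfold mu
  rw [lintegral_withDensity_eq_lintegral_mul_non_measurable _ (by fun_prop)
    (Eventually.of_forall fun _ => ENNReal.ofReal_lt_top)]
  rfl

lemma lintegral_angleMeasure (α : ℝ) (F : ℝ → ℝ≥0∞) :
    ∫⁻ θ, F θ ∂(angleMeasure α) = ∫⁻ θ in Ioo (0 : ℝ) Real.pi,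
      ENNReal.ofReal (Real.Gamma (α + 1) /
      (Real.Gamma (1 / 2) * Real.Gamma (α + 1 / 2)) * Real.sin θ ^ (2 * α)) * F θ := by
  unfold angleMeasure
  rw [lintegral_withDensity_eq_lintegral_mul_non_measurable _ (by fun_prop)
    (Eventually.of_forall fun _ => ENNReal.ofReal_lt_top)]
  rfl

lemma integral_angleMeasure {α : ℝ} (hα : -(1 / 2) < α) (F : ℝ → ℂ) :
    ∫ θ, F θ ∂(angleMeasure α) =
      ((Real.Gamma (α + 1) / (Real.Gamma (1 / 2) * Real.Gamma (α + 1 / 2)) : ℝ) : ℂ) *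
        ∫ θ in (0 : ℝ)..Real.pi, F θ * ((Real.sin θ ^ (2 * α) : ℝ) : ℂ) := by
  unfold angleMeasure
  rw [integral_withDensity_eq_integral_toReal_smul (by fun_prop)
    (Eventually.of_forall fun _ => ENNReal.ofReal_lt_top),
    intervalIntegral.integral_of_le Real.pi_pos.le, integral_Ioc_eq_integral_Ioo,
    ← integral_const_mul]
  refine setIntegral_congr_fun measurableSet_Ioo fun x hx => ?_
  rw [ENNReal.toReal_ofReal, Complex.real_smul]
  · push_cast; ring
  · exact mul_nonneg (angle_const_pos hα).le
      (Real.rpow_nonneg (Real.sin_nonneg_of_mem_Icc ⟨hx.1.le, hx.2.le⟩) _)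

lemma translation_eq {α : ℝ} (hα : -(1 / 2) < α) (x : ℝ) (f : ℝ → ℂ) (y : ℝ) :
    translation α x f y = ∫ θ, f (triSide x y θ) ∂(angleMeasure α) := by
  rw [integral_angleMeasure hα]; rfl

/-- Polar coordinates: up to a constant, `mu α` times the angular measure is the measure
`v ^ (2α) du dv` on the upper half-plane. -/
lemma lintegral_polar {α : ℝ} (hα : -(1 / 2) < α) {H : ℝ × ℝ → ℝ≥0∞} (hH : Measurable H) :
    ∫⁻ y, ∫⁻ θ, H (y * Real.cos θ, y * Real.sin θ) ∂(angleMeasure α) ∂(mu α) =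
      ENNReal.ofReal (Real.Gamma (α + 1) / (Real.Gamma (1 / 2) * Real.Gamma (α + 1 / 2)) /
        (2 ^ α * Real.Gamma (α + 1))) *
      ∫⁻ p : ℝ × ℝ, {p : ℝ × ℝ | 0 < p.2}.indicator
        (fun p => ENNReal.ofReal (p.2 ^ (2 * α)) * H p) p := by
  have hms : MeasurableSet {p : ℝ × ℝ | 0 < p.2} := measurableSet_lt measurable_const measurable_snd
  have hG : Measurable ({p : ℝ × ℝ | 0 < p.2}.indicator
        (fun p => ENNReal.ofReal (p.2 ^ (2 * α)) * H p)) :=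
    Measurable.indicator (by fun_prop) hms
  rw [← lintegral_comp_polarCoord_symm, polarCoord_target, Measure.volume_eq_prod,
    ← Measure.prod_restrict, lintegral_prod _ (by
      refine Measurable.aemeasurable ?_
      refine Measurable.smul measurable_fst.ennreal_ofReal 
        (hG.comp continuous_polarCoord_symm.measurable)), lintegral_mu,
    ← lintegral_const_mul' _ _ ENNReal.ofReal_ne_top]
  refine setLIntegral_congr_fun measurableSet_Ioi fun r (hr : 0 < r) => ?_
  simp only [polarCoord_symm_apply, smul_eq_mul]
  rw [lintegral_angleMeasure, ← lintegral_const_mul' _ _ ENNReal.ofReal_ne_top,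
    ← lintegral_const_mul' _ _ ENNReal.ofReal_ne_top,
    ← lintegral_indicator measurableSet_Ioo, ← lintegral_indicator measurableSet_Ioo]
  refine lintegral_congr fun θ => ?_
  by_cases h1 : θ ∈ Ioo 0 Real.pi
  · have h2 : θ ∈ Ioo (-Real.pi) Real.pi := ⟨by linarith [h1.1, Real.pi_pos], h1.2⟩
    have hs := Real.sin_pos_of_mem_Ioo h1
    rw [indicator_of_mem h1, indicator_of_mem h2, indicator_of_mem (by exact mul_pos hr hs)]
    rw [← mul_assoc, ← mul_assoc, ← mul_assoc]
    congr 1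
    have hc := angle_const_pos hα
    have hn := norm_const_pos hα
    rw [← ENNReal.ofReal_mul (by positivity), ← ENNReal.ofReal_mul (by positivity),
      ← ENNReal.ofReal_mul (by positivity)]
    congr 1
    rw [Real.mul_rpow hr.le hs.le, Real.rpow_add_one hr.ne']
    ring
  · rw [indicator_of_notMem h1]
    by_cases h2 : θ ∈ Ioo (-Real.pi) Real.pi
    · rw [indicator_of_mem h2, indicator_of_notMem, mul_zero, mul_zero]
      have : Real.sin θ ≤ 0 := by
        refine Real.sin_nonpos_of_nonpos_of_neg_pi_le ?_ h2.1.le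
        by_contra h
        exact h1 ⟨not_le.mp h, h2.2⟩
      exact not_lt.mpr (mul_nonpos_of_nonneg_of_nonpos hr.le this)
    · rw [indicator_of_notMem h2]

/-- Exchanging a side: the joint law of `(|w + x e₁|, |w|)` for `w` in the half-plane is symmetric,
because `v ^ (2α) du dv` is invariant under `u ↦ u - x` and `u ↦ -u`. -/
lemma lintegral_triSide_swap {α : ℝ} (hα : -(1 / 2) < α) (x : ℝ) {F : ℝ × ℝ → ℝ≥0∞}
    (hF : Measurable F) :
    ∫⁻ y, ∫⁻ θ, F (triSide x y θ, y) ∂(angleMeasure α) ∂(mu α) =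
      ∫⁻ y, ∫⁻ θ, F (y, triSide x y θ) ∂(angleMeasure α) ∂(mu α) := by
  have key : ∀ y θ : ℝ, 0 < y → √((y * Real.cos θ + x) ^ 2 + (y * Real.sin θ) ^ 2) = triSide x y θ ∧
      √((y * Real.cos θ) ^ 2 + (y * Real.sin θ) ^ 2) = y := by
    intro y θ hy
    constructor
    · unfold triSide; congr 1; linear_combination y ^ 2 * Real.sin_sq_add_cos_sq θ
    · rw [show (y * Real.cos θ) ^ 2 + (y * Real.sin θ) ^ 2 = y ^ 2 by
        linear_combination y ^ 2 * Real.sin_sq_add_cos_sq θ, Real.sqrt_sq hy.le]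
  have e1 : ∫⁻ y, ∫⁻ θ, F (triSide x y θ, y) ∂(angleMeasure α) ∂(mu α) =
      ∫⁻ y, ∫⁻ θ, (fun p : ℝ × ℝ => F (√((p.1 + x) ^ 2 + p.2 ^ 2), √(p.1 ^ 2 + p.2 ^ 2)))
        (y * Real.cos θ, y * Real.sin θ) ∂(angleMeasure α) ∂(mu α) := by
    refine lintegral_congr_ae ?_
    filter_upwards [ae_mu_pos α] with y hy
    simp only [(key y _ hy).1, (key y _ hy).2]
  have e2 : ∫⁻ y, ∫⁻ θ, F (y, triSide x y θ) ∂(angleMeasure α) ∂(mu α) =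
      ∫⁻ y, ∫⁻ θ, (fun p : ℝ × ℝ => F (√(p.1 ^ 2 + p.2 ^ 2), √((p.1 + x) ^ 2 + p.2 ^ 2)))
        (y * Real.cos θ, y * Real.sin θ) ∂(angleMeasure α) ∂(mu α) := by
    refine lintegral_congr_ae ?_
    filter_upwards [ae_mu_pos α] with y hy
    simp only [(key y _ hy).1, (key y _ hy).2]
  have hms : MeasurableSet {p : ℝ × ℝ | 0 < p.2} := measurableSet_lt measurable_const measurable_snd
  have m1 : Measurable fun p : ℝ × ℝ => F (√((p.1 + x) ^ 2 + p.2 ^ 2), √(p.1 ^ 2 + p.2 ^ 2)) := by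
    fun_prop
  have m2 : Measurable fun p : ℝ × ℝ => F (√(p.1 ^ 2 + p.2 ^ 2), √((p.1 + x) ^ 2 + p.2 ^ 2)) := by
    fun_prop
  rw [e1, e2, lintegral_polar hα m1, lintegral_polar hα m2]
  congr 1
  rw [Measure.volume_eq_prod, lintegral_prod_symm _ (Measurable.aemeasurable
    (Measurable.indicator (by fun_prop) hms)), lintegral_prod_symm _ (Measurable.aemeasurable
    (Measurable.indicator (by fun_prop) hms))]
  refine lintegral_congr fun v => ?_
  rw [← lintegral_sub_right_eq_self _ x, ← lintegral_neg_eq_self]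
  refine lintegral_congr fun u => ?_
  by_cases hv : 0 < v
  · rw [indicator_of_mem (by exact hv), indicator_of_mem (by exact hv)]
    simp only
    congr 4 <;> ring
  · rw [indicator_of_notMem (by exact hv), indicator_of_notMem (by exact hv)]

lemma lintegral_rpow_mul_exp {p q b : ℝ} (hp : 0 < p) (hq : -1 < q) (hb : 0 < b) :
    ∫⁻ x in Ioi (0 : ℝ), ENNReal.ofReal (x ^ q * Real.exp (-b * x ^ p)) =
      ENNReal.ofReal (b ^ (-(q + 1) / p) * (1 / p) * Real.Gamma ((q + 1) / p)) := by
  rw [← integral_rpow_mul_exp_neg_mul_rpow hp hq hb, ofReal_integral_eq_lintegral_ofReal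
    (integrableOn_rpow_mul_exp_neg_mul_rpow hq hp hb)]
  filter_upwards [ae_restrict_mem measurableSet_Ioi] with x hx
  exact mul_nonneg (Real.rpow_nonneg (le_of_lt hx) _) (Real.exp_pos _).le

lemma lintegral_gaussian_mu {α : ℝ} (hα : -(1 / 2) < α) {b : ℝ} (hb : 0 < b) :
    ∫⁻ x, ENNReal.ofReal (Real.exp (-b * x ^ 2)) ∂(mu α) =
      ENNReal.ofReal ((2 * b) ^ (-(α + 1))) := by
  have hn := norm_const_pos hα
  have hG : 0 < Real.Gamma (α + 1) := Real.Gamma_pos_of_pos (by linarith)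
  rw [lintegral_mu]
  have : ∀ x ∈ Ioi (0 : ℝ), ENNReal.ofReal (x ^ (2 * α + 1) / (2 ^ α * Real.Gamma (α + 1))) *
      ENNReal.ofReal (Real.exp (-b * x ^ 2)) = ENNReal.ofReal ((2 ^ α * Real.Gamma (α + 1))⁻¹) *
      ENNReal.ofReal (x ^ (2 * α + 1) * Real.exp (-b * x ^ (2 : ℝ))) := by
    intro x hx
    have := Real.rpow_nonneg (le_of_lt hx) (2 * α + 1)
    rw [← ENNReal.ofReal_mul (by positivity), ← ENNReal.ofReal_mul (by positivity),
      Real.rpow_two]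
    congr 1; ring
  rw [setLIntegral_congr_fun measurableSet_Ioi this, lintegral_const_mul' _ _ ENNReal.ofReal_ne_top,
    lintegral_rpow_mul_exp two_pos (by linarith) hb, ← ENNReal.ofReal_mul (by positivity)]
  congr 1
  rw [show (2 * α + 1 + 1) / 2 = α + 1 by ring, show -(2 * α + 1 + 1) / 2 = -(α + 1) by ring,
    Real.mul_rpow (by norm_num) hb.le, Real.rpow_neg (by norm_num : (0:ℝ) ≤ 2),
    Real.rpow_add_one (by norm_num)]
  field_simp

lemma angleMeasure_univ {α : ℝ} (hα : -(1 / 2) < α) : angleMeasure α univ = 1 := by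
  have h := lintegral_polar hα (H := fun p => ENNReal.ofReal (Real.exp (-1 * p.1 ^ 2)) *
    ENNReal.ofReal (Real.exp (-1 * p.2 ^ 2))) (by fun_prop)
  have hG1 : 0 < Real.Gamma (α + 1) := Real.Gamma_pos_of_pos (by linarith)
  have hG2 : 0 < Real.Gamma (α + 1 / 2) := Real.Gamma_pos_of_pos (by linarith)
  have hl : ∀ y θ : ℝ, ENNReal.ofReal (Real.exp (-1 * (y * Real.cos θ) ^ 2)) *
      ENNReal.ofReal (Real.exp (-1 * (y * Real.sin θ) ^ 2)) =
      ENNReal.ofReal (Real.exp (-1 * y ^ 2)) := by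
    intro y θ
    rw [← ENNReal.ofReal_mul (Real.exp_pos _).le, ← Real.exp_add]
    congr 2
    linear_combination -y ^ 2 * Real.sin_sq_add_cos_sq θ
  simp only [hl, lintegral_const] at h
  rw [lintegral_mul_const _ (by fun_prop), lintegral_gaussian_mu hα one_pos,
    Measure.volume_eq_prod] at h
  have hind : ∀ p : ℝ × ℝ, {p : ℝ × ℝ | 0 < p.2}.indicator (fun p : ℝ × ℝ =>
      ENNReal.ofReal (p.2 ^ (2 * α)) * (ENNReal.ofReal (Real.exp (-1 * p.1 ^ 2)) *
        ENNReal.ofReal (Real.exp (-1 * p.2 ^ 2)))) p =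
      ENNReal.ofReal (Real.exp (-1 * p.1 ^ 2)) * (Ioi (0 : ℝ)).indicator
        (fun v => ENNReal.ofReal (v ^ (2 * α) * Real.exp (-1 * v ^ (2 : ℝ)))) p.2 := by
    intro p
    by_cases hv : 0 < p.2
    · rw [indicator_of_mem (by exact hv), indicator_of_mem (by exact hv),
        ENNReal.ofReal_mul (by positivity), Real.rpow_two]
      ring
    · rw [indicator_of_notMem (by exact hv), indicator_of_notMem (by exact hv), mul_zero]
  rw [lintegral_congr hind, lintegral_prod_mul
    (f := fun u : ℝ => ENNReal.ofReal (Real.exp (-1 * u ^ 2))) (by fun_prop)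
    (Measurable.aemeasurable (Measurable.indicator (by fun_prop) measurableSet_Ioi)),
    lintegral_indicator measurableSet_Ioi, lintegral_rpow_mul_exp two_pos (by linarith) one_pos,
    ← ofReal_integral_eq_lintegral_ofReal (integrable_exp_neg_mul_sq one_pos)
      (Eventually.of_forall fun _ => (Real.exp_pos _).le), integral_gaussian] at h
  have h2 : (2 * 1 : ℝ) ^ (-(α + 1)) = Real.Gamma (α + 1) /
      (Real.Gamma (1 / 2) * Real.Gamma (α + 1 / 2)) / (2 ^ α * Real.Gamma (α + 1)) *
      (√(Real.pi / 1) * (1 ^ (-(2 * α + 1) / 2) * (1 / 2) * Real.Gamma ((2 * α + 1) / 2))) := by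
    rw [Real.Gamma_one_half_eq, show (2 * α + 1) / 2 = α + 1 / 2 by ring, Real.one_rpow,
      Real.rpow_neg (by norm_num : (0:ℝ) ≤ 2 * 1), mul_one,
      Real.rpow_add_one (by norm_num)]
    have := Real.sqrt_pos.mpr Real.pi_pos
    rw [div_one]
    generalize Real.Gamma (α + 1 / 2) = G at *
    field_simp
  rw [← ENNReal.ofReal_mul (by positivity), ← ENNReal.ofReal_mul (by positivity), ← h2] at h
  have hne : ENNReal.ofReal ((2 * 1 : ℝ) ^ (-(α + 1))) ≠ 0 := by
    rw [ne_eq, ENNReal.ofReal_eq_zero, not_le]; positivity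
  exact (ENNReal.mul_eq_left hne ENNReal.ofReal_ne_top).mp h

/-! ### Moments of the angular measure -/

lemma isProbabilityMeasure_angleMeasure {α : ℝ} (hα : -(1 / 2) < α) :
    IsProbabilityMeasure (angleMeasure α) := ⟨angleMeasure_univ hα⟩

lemma integral_angleMeasure_real {α : ℝ} (hα : -(1 / 2) < α) (F : ℝ → ℝ) :
    ∫ θ, F θ ∂(angleMeasure α) = ∫ θ in (0 : ℝ)..Real.pi,
      Real.Gamma (α + 1) / (Real.Gamma (1 / 2) * Real.Gamma (α + 1 / 2)) *
        Real.sin θ ^ (2 * α) * F θ := by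
  unfold angleMeasure
  rw [integral_withDensity_eq_integral_toReal_smul (by fun_prop)
    (Eventually.of_forall fun _ => ENNReal.ofReal_lt_top),
    intervalIntegral.integral_of_le Real.pi_pos.le, integral_Ioc_eq_integral_Ioo]
  refine setIntegral_congr_fun measurableSet_Ioo fun x hx => ?_
  rw [ENNReal.toReal_ofReal, smul_eq_mul]
  exact mul_nonneg (angle_const_pos hα).le
      (Real.rpow_nonneg (Real.sin_nonneg_of_mem_Icc ⟨hx.1.le, hx.2.le⟩) _)

lemma intervalIntegrable_sin_rpow_mul {α : ℝ} (hα : -(1 / 2) < α) {F : ℝ → ℝ}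
    (hF : Continuous F) :
    IntervalIntegrable (fun θ => Real.Gamma (α + 1) /
      (Real.Gamma (1 / 2) * Real.Gamma (α + 1 / 2)) * Real.sin θ ^ (2 * α) * F θ)
      volume 0 Real.pi := by
  have := isProbabilityMeasure_angleMeasure hα
  obtain ⟨C, hC⟩ := isCompact_Icc.exists_bound_of_continuousOn (s := Icc 0 Real.pi) hF.continuousOn
  have hint : Integrable F (angleMeasure α) := by
    refine Integrable.of_bound hF.aestronglyMeasurable C ?_
    refine (withDensity_absolutelyContinuous _ _).ae_le ?_
    filter_upwards [ae_restrict_mem measurableSet_Ioo] with x hx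
    exact hC x ⟨hx.1.le, hx.2.le⟩
  unfold angleMeasure at hint
  rw [integrable_withDensity_iff_integrable_smul' (by fun_prop)
    (Eventually.of_forall fun _ => ENNReal.ofReal_lt_top)] at hint
  rw [intervalIntegrable_iff_integrableOn_Ioo_of_le Real.pi_pos.le]
  refine IntegrableOn.congr_fun hint (fun x hx => ?_) measurableSet_Ioo
  simp only [smul_eq_mul]
  rw [ENNReal.toReal_ofReal]
  exact mul_nonneg (angle_const_pos hα).le
      (Real.rpow_nonneg (Real.sin_nonneg_of_mem_Icc ⟨hx.1.le, hx.2.le⟩) _)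

/-- Integration by parts against the angular weight: the derivative of `sin ^ (2α+1) · G(cos)`
integrates to zero. -/
lemma integral_angleMeasure_deriv {α : ℝ} (hα : -(1 / 2) < α) {G G' : ℝ → ℝ}
    (hG : ∀ c, HasDerivAt G (G' c) c) (hG' : Continuous G') :
    ∫ θ, ((2 * α + 1) * Real.cos θ * G (Real.cos θ) -
      (1 - Real.cos θ ^ 2) * G' (Real.cos θ)) ∂(angleMeasure α) = 0 := by
  have hGc : Continuous G := continuous_iff_continuousAt.mpr fun c => (hG c).continuousAt
  rw [integral_angleMeasure_real hα, intervalIntegral.integral_eq_sub_of_hasDerivAt_of_le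
    (f := fun θ => Real.Gamma (α + 1) / (Real.Gamma (1 / 2) * Real.Gamma (α + 1 / 2)) *
      (Real.sin θ ^ (2 * α + 1) * G (Real.cos θ))) Real.pi_pos.le]
  · simp [Real.zero_rpow (show 2 * α + 1 ≠ 0 by linarith)]
  · refine Continuous.continuousOn ?_
    have : Continuous fun θ => Real.sin θ ^ (2 * α + 1) :=
      Real.continuous_sin.rpow_const fun _ => Or.inr (by linarith)
    fun_prop
  · intro θ hθ
    have hs := Real.sin_pos_of_mem_Ioo hθ
    have h1 := (Real.hasDerivAt_sin θ).rpow_const (p := 2 * α + 1) (Or.inl hs.ne')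
    have h2 := (hG (Real.cos θ)).comp θ (Real.hasDerivAt_cos θ)
    convert! (h1.mul h2).const_mul
      (Real.Gamma (α + 1) / (Real.Gamma (1 / 2) * Real.Gamma (α + 1 / 2))) using 1
    rw [add_sub_cancel_right, Real.rpow_add_one hs.ne', Function.comp, ← Real.sin_sq]
    ring
  · exact intervalIntegrable_sin_rpow_mul hα (by fun_prop)

lemma integrable_angleMeasure {α : ℝ} (hα : -(1 / 2) < α) {E : Type*} [NormedAddCommGroup E]
    {F : ℝ → E} {C : ℝ} (hF : AEStronglyMeasurable F (angleMeasure α)) (hC : ∀ θ, ‖F θ‖ ≤ C) :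
    Integrable F (angleMeasure α) :=
  have := isProbabilityMeasure_angleMeasure hα
  Integrable.of_bound hF C (Eventually.of_forall hC)

lemma norm_cos_pow_le (n : ℕ) (θ : ℝ) : ‖Real.cos θ ^ n‖ ≤ 1 := by
  rw [norm_pow]; exact pow_le_one₀ (norm_nonneg _) (Real.abs_cos_le_one θ)

lemma integrable_cos_pow {α : ℝ} (hα : -(1 / 2) < α) (n : ℕ) :
    Integrable (fun θ => Real.cos θ ^ n) (angleMeasure α) :=
  integrable_angleMeasure hα (by fun_prop) (norm_cos_pow_le n)

lemma moment_cos_succ {α : ℝ} (hα : -(1 / 2) < α) (n : ℕ) :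
    (n + 2 * α + 2) * ∫ θ, Real.cos θ ^ (n + 2) ∂(angleMeasure α) =
      (n + 1) * ∫ θ, Real.cos θ ^ n ∂(angleMeasure α) := by
  have h := integral_angleMeasure_deriv hα (G := fun c => c ^ (n + 1))
    (G' := fun c => ((n + 1 : ℕ) : ℝ) * c ^ n) (fun c => hasDerivAt_pow (n + 1) c) (by fun_prop)
  have h2 : ∀ θ : ℝ, (2 * α + 1) * Real.cos θ * Real.cos θ ^ (n + 1) -
      (1 - Real.cos θ ^ 2) * (((n + 1 : ℕ) : ℝ) * Real.cos θ ^ n) =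
      (n + 2 * α + 2) * Real.cos θ ^ (n + 2) - (n + 1) * Real.cos θ ^ n := by
    intro θ; push_cast; ring
  simp only [h2] at h
  rw [integral_sub ((integrable_cos_pow hα _).const_mul _) ((integrable_cos_pow hα _).const_mul _),
    integral_const_mul, integral_const_mul] at h
  linarith

lemma moment_cos_odd {α : ℝ} (hα : -(1 / 2) < α) (j : ℕ) :
    ∫ θ, Real.cos θ ^ (2 * j + 1) ∂(angleMeasure α) = 0 := by
  induction j with
  | zero =>
    have h := integral_angleMeasure_deriv hα (G := fun _ => 1) (G' := fun _ => 0)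
      (fun c => hasDerivAt_const c 1) (by fun_prop)
    simp only [mul_one, mul_zero, sub_zero] at h
    rw [integral_const_mul] at h
    simpa [show 2 * α + 1 ≠ 0 by linarith] using h
  | succ j ih =>
    have h := moment_cos_succ hα (2 * j + 1)
    rw [ih, mul_zero] at h
    refine (mul_eq_zero.mp h).resolve_left (ne_of_gt ?_)
    push_cast
    have : (0 : ℝ) ≤ j := j.cast_nonneg
    linarith

lemma gamma_add_pos {α : ℝ} (hα : -(1 / 2) < α) (n : ℕ) : 0 < Real.Gamma (n + α + 1) :=
  Real.Gamma_pos_of_pos (by have : (0 : ℝ) ≤ n := n.cast_nonneg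
                            linarith)

lemma gamma_add_succ {α : ℝ} (hα : -(1 / 2) < α) (n : ℕ) :
    Real.Gamma ((n + 1 : ℕ) + α + 1) = (n + α + 1) * Real.Gamma (n + α + 1) := by
  rw [← Real.Gamma_add_one]
  · push_cast; congr 1; ring
  · have : (0 : ℝ) ≤ n := n.cast_nonneg
    linarith

lemma moment_cos_even {α : ℝ} (hα : -(1 / 2) < α) (j : ℕ) :
    ∫ θ, Real.cos θ ^ (2 * j) ∂(angleMeasure α) =
      (2 * j).factorial * Real.Gamma (α + 1) / (4 ^ j * j.factorial * Real.Gamma (j + α + 1)) := by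
  have := isProbabilityMeasure_angleMeasure hα
  have hG : 0 < Real.Gamma (α + 1) := Real.Gamma_pos_of_pos (by linarith)
  induction j with
  | zero => simp [hG.ne']
  | succ j ih =>
    have h := moment_cos_succ hα (2 * j)
    have hj : (0 : ℝ) ≤ j := j.cast_nonneg
    have hp : (0 : ℝ) < (2 * j : ℕ) + 2 * α + 2 := by push_cast; linarith
    have hp' : (0 : ℝ) < j + α + 1 := by linarith
    have := gamma_add_pos hα j
    rw [ih] at h
    rw [show 2 * (j + 1) = 2 * j + 2 by ring, ← mul_right_inj' hp.ne', h, gamma_add_succ hα,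
      Nat.factorial_succ, Nat.factorial_succ, Nat.factorial_succ]
    push_cast
    field_simp
    ring

/-! ### The product formula for spherical Bessel functions -/

/-- A Chu–Vandermonde identity. -/
lemma sum_choose_mul_choose_div_gamma (k : ℕ) : ∀ (m : ℕ) (b : ℝ), 0 < b →
    ∑ j ∈ Finset.range (k + 1), (k.choose j : ℝ) * m.choose j * j.factorial / Real.Gamma (b + j) =
      Real.Gamma (b + k + m) / (Real.Gamma (b + k) * Real.Gamma (b + m)) := by
  induction k with
  | zero =>
    intro m b hb
    have := Real.Gamma_pos_of_pos hb
    have := Real.Gamma_pos_of_pos (show 0 < b + m by positivity)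
    simp
    field_simp
  | succ k ih =>
    intro m b hb
    have e1 : ∀ j ∈ Finset.range (k + 1), ((k + 1).choose (j + 1) : ℝ) * m.choose (j + 1) *
        (j + 1).factorial / Real.Gamma (b + (j + 1 : ℕ)) =
        (k.choose (j + 1) : ℝ) * m.choose (j + 1) *
        (j + 1).factorial / Real.Gamma (b + (j + 1 : ℕ)) +
        m * ((k.choose j : ℝ) * (m - 1).choose j * j.factorial / Real.Gamma (b + 1 + j)) := by
      intro j _
      have h : (m.choose (j + 1) : ℝ) * (j + 1) = m * (m - 1).choose j := by
        cases m with
        | zero => simp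
        | succ m => exact_mod_cast (Nat.add_one_mul_choose_eq m j).symm
      rw [Nat.choose_succ_succ, Nat.factorial_succ,
        show b + ((j + 1 : ℕ) : ℝ) = b + 1 + j by push_cast; ring]
      push_cast
      linear_combination (k.choose j : ℝ) * j.factorial / Real.Gamma (b + 1 + j) * h
    rw [Finset.sum_range_succ', Finset.sum_congr rfl e1, Finset.sum_add_distrib,
      ← Finset.mul_sum, ih (m - 1) (b + 1) (by positivity)]
    have e2 := Finset.sum_range_succ' (fun j => (k.choose j : ℝ) * m.choose j *
        j.factorial / Real.Gamma (b + j)) (k + 1)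
    rw [Finset.sum_range_succ, ih m b hb] at e2
    simp only [Nat.choose_succ_self, Nat.cast_zero, zero_mul, zero_div, add_zero,
      Nat.choose_zero_right] at e2 ⊢
    rw [add_right_comm, ← e2]
    have hp1 : 0 < b + k := by positivity
    have hp2 : 0 < b + k + m := by positivity
    have g1 := Real.Gamma_pos_of_pos hp1
    have g2 := Real.Gamma_pos_of_pos hp2
    have g3 := Real.Gamma_pos_of_pos (show 0 < b + m by positivity)
    have c1 : b + 1 + (k : ℝ) = b + k + 1 := by ring
    have c2 : b + ((k + 1 : ℕ) : ℝ) = b + k + 1 := by push_cast; ring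
    rw [c1, c2, show b + (k : ℝ) + 1 + m = b + k + m + 1 by ring, Real.Gamma_add_one hp1.ne',
      Real.Gamma_add_one hp2.ne']
    cases m with
    | zero =>
      simp only [Nat.cast_zero, add_zero, zero_mul] at *
      field_simp
    | succ m =>
      simp only [Nat.add_sub_cancel]
      have c3 : b + (k : ℝ) + 1 + (m : ℝ) = b + k + (m + 1 : ℕ) := by push_cast; ring
      have c4 : b + 1 + (m : ℝ) = b + (m + 1 : ℕ) := by push_cast; ring
      rw [c3, c4]
      field_simp

/-- The identity behind the product formula, after clearing binomial coefficients. -/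
lemma sum_inv_factorial_div_gamma (k m : ℕ) {b : ℝ} (hb : 0 < b) :
    ∑ j ∈ Finset.range (min k m + 1), 1 / ((k - j).factorial * (m - j).factorial * j.factorial *
      Real.Gamma (b + j)) = Real.Gamma (b + k + m) /
        (k.factorial * m.factorial * Real.Gamma (b + k) * Real.Gamma (b + m)) := by
  have h := sum_choose_mul_choose_div_gamma k m b hb
  have hsub : Finset.range (min k m + 1) ⊆ Finset.range (k + 1) := by
    intro j; simp only [Finset.mem_range]; omega
  rw [← Finset.sum_subset hsub (by
    intro j h1 h2
    simp only [Finset.mem_range] at h1 h2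
    rw [Nat.choose_eq_zero_of_lt (show m < j by omega)]
    simp)] at h
  have hk : (k.factorial : ℝ) ≠ 0 := by positivity
  have hm : (m.factorial : ℝ) ≠ 0 := by positivity
  calc _ = ∑ j ∈ Finset.range (min k m + 1), (k.choose j : ℝ) * m.choose j * j.factorial /
        Real.Gamma (b + j) / (k.factorial * m.factorial) := by
        refine Finset.sum_congr rfl fun j hj => ?_
        simp only [Finset.mem_range] at hj
        have h1 := Nat.choose_mul_factorial_mul_factorial (show j ≤ k by omega)
        have h2 := Nat.choose_mul_factorial_mul_factorial (show j ≤ m by omega)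
        have g := Real.Gamma_pos_of_pos (show 0 < b + j by positivity)
        rw [← h1, ← h2]
        have := Nat.choose_pos (show j ≤ k by omega)
        have := Nat.choose_pos (show j ≤ m by omega)
        push_cast
        field_simp
    _ = _ := by
        rw [← Finset.sum_div, h]
        field_simp

/-- The angular average of an even power of the side length. Multiplied by the `n`-th coefficient
of `j_α` it becomes the `n`-th term of a Cauchy product, which is why `j_α` satisfies a product
formula. -/
lemma integral_triSide_pow {α : ℝ} (hα : -(1 / 2) < α) (x y : ℝ) (n : ℕ) :
    ∫ θ, (x ^ 2 + y ^ 2 + 2 * x * y * Real.cos θ) ^ n ∂(angleMeasure α) =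
      n.factorial * Real.Gamma (n + α + 1) * Real.Gamma (α + 1) *
        ∑ p ∈ Finset.HasAntidiagonal.antidiagonal n,
          x ^ (2 * p.1) / (p.1.factorial * Real.Gamma (p.1 + α + 1)) *
          (y ^ (2 * p.2) / (p.2.factorial * Real.Gamma (p.2 + α + 1))) := by
  have e1 : ∫ θ, (x ^ 2 + y ^ 2 + 2 * x * y * Real.cos θ) ^ n ∂(angleMeasure α) =
      (n.factorial : ℝ) * ∑ i ∈ Finset.range (n + 1), (2 * x * y) ^ i / i.factorial *
        (∫ θ, Real.cos θ ^ i ∂(angleMeasure α)) *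
          ((x ^ 2 + y ^ 2) ^ (n - i) / (n - i).factorial) := by
    have : ∀ θ : ℝ, (x ^ 2 + y ^ 2 + 2 * x * y * Real.cos θ) ^ n =
        ∑ i ∈ Finset.range (n + 1), n.factorial * ((2 * x * y) ^ i / i.factorial *
          ((x ^ 2 + y ^ 2) ^ (n - i) / (n - i).factorial)) * Real.cos θ ^ i := by
      intro θ
      rw [add_comm, add_pow]
      refine Finset.sum_congr rfl fun i hi => ?_
      have hi' : i ≤ n := by simpa [Nat.lt_succ_iff] using hi
      rw [← Nat.choose_mul_factorial_mul_factorial hi', mul_pow (2 * x * y)]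
      push_cast
      field_simp
    simp only [this]
    rw [integral_finsetSum _ fun i _ => (integrable_cos_pow hα i).const_mul _, Finset.mul_sum]
    refine Finset.sum_congr rfl fun i _ => ?_
    rw [integral_const_mul]; ring
  -- only even powers of the cosine contribute
  have e2 : ∑ i ∈ Finset.range (n + 1), (2 * x * y) ^ i / i.factorial *
        (∫ θ, Real.cos θ ^ i ∂(angleMeasure α)) *
          ((x ^ 2 + y ^ 2) ^ (n - i) / (n - i).factorial) =
      ∑ j ∈ Finset.range (n / 2 + 1), (x * y) ^ (2 * j) * Real.Gamma (α + 1) /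
        (j.factorial * Real.Gamma (j + α + 1)) *
          ((x ^ 2 + y ^ 2) ^ (n - 2 * j) / (n - 2 * j).factorial) := by
    have hinj : Set.InjOn (fun j => 2 * j) (Finset.range (n / 2 + 1) : Set ℕ) :=
      fun a _ b _ h => by simpa using h
    have hsub : (Finset.range (n / 2 + 1)).image (fun j => 2 * j) ⊆ Finset.range (n + 1) := by
      intro i hi
      simp only [Finset.mem_image, Finset.mem_range] at hi ⊢
      omega
    rw [← Finset.sum_subset hsub, Finset.sum_image hinj]
    · refine Finset.sum_congr rfl fun j _ => ?_
      rw [moment_cos_even hα, show (2 * x * y) ^ (2 * j) = 4 ^ j * (x * y) ^ (2 * j) by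
        rw [pow_mul, pow_mul, ← mul_pow]; congr 1; ring]
      have := gamma_add_pos hα j
      field_simp
    · intro i hi hi'
      obtain ⟨j, rfl | rfl⟩ := i.even_or_odd'
      · refine absurd ?_ hi'
        simp only [Finset.mem_image, Finset.mem_range] at hi ⊢
        exact ⟨j, by omega, rfl⟩
      · rw [moment_cos_odd hα]; ring
  have e3 : ∀ N : ℕ, (x ^ 2 + y ^ 2) ^ N / N.factorial =
      ∑ p ∈ Finset.HasAntidiagonal.antidiagonal N,
      x ^ (2 * p.1) / p.1.factorial * (y ^ (2 * p.2) / p.2.factorial) := by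
    intro N
    rw [(Commute.all (x ^ 2) (y ^ 2)).add_pow', Finset.sum_div]
    refine Finset.sum_congr rfl fun p hp => ?_
    rw [Finset.HasAntidiagonal.mem_antidiagonal] at hp
    subst hp
    have h1 := Nat.add_choose_mul_factorial_mul_factorial p.1 p.2
    rw [← Nat.choose_symm_add] at h1
    rw [← h1, nsmul_eq_mul, pow_mul, pow_mul]
    have := Nat.choose_pos (show p.1 ≤ p.1 + p.2 by omega)
    push_cast
    field_simp
  have e4 : ∀ p ∈ Finset.HasAntidiagonal.antidiagonal n, Real.Gamma (n + α + 1) *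
      (x ^ (2 * p.1) / (p.1.factorial * Real.Gamma (p.1 + α + 1)) *
          (y ^ (2 * p.2) / (p.2.factorial * Real.Gamma (p.2 + α + 1)))) =
      ∑ j ∈ Finset.range (min p.1 p.2 + 1), x ^ (2 * p.1) * y ^ (2 * p.2) *
        (1 / ((p.1 - j).factorial * (p.2 - j).factorial * j.factorial *
          Real.Gamma (j + α + 1))) := by
    intro p hp
    rw [Finset.HasAntidiagonal.mem_antidiagonal] at hp
    have h := sum_inv_factorial_div_gamma p.1 p.2 (b := α + 1) (by linarith)
    have hc : ∀ j : ℝ, α + 1 + j = j + α + 1 := fun j => by ring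
    simp only [hc] at h
    rw [← Finset.mul_sum, h, ← hp]
    push_cast
    rw [show (p.1 : ℝ) + α + 1 + p.2 = p.1 + p.2 + α + 1 by ring]
    have := gamma_add_pos hα p.1
    have := gamma_add_pos hα p.2
    field_simp
  rw [e1, e2]
  simp only [e3, Finset.mul_sum]
  rw [Finset.sum_sigma']
  have e5 : ∀ p ∈ Finset.HasAntidiagonal.antidiagonal n,
      n.factorial * Real.Gamma (n + α + 1) * Real.Gamma (α + 1) *
        (x ^ (2 * p.1) / (p.1.factorial * Real.Gamma (p.1 + α + 1)) *
          (y ^ (2 * p.2) / (p.2.factorial * Real.Gamma (p.2 + α + 1)))) =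
      ∑ j ∈ Finset.range (min p.1 p.2 + 1), n.factorial * Real.Gamma (α + 1) *
        (x ^ (2 * p.1) * y ^ (2 * p.2) *
        (1 / ((p.1 - j).factorial * (p.2 - j).factorial * j.factorial *
          Real.Gamma (j + α + 1)))) := by
    intro p hp
    rw [← Finset.mul_sum, ← e4 p hp]; ring
  rw [Finset.sum_congr rfl e5, Finset.sum_sigma']
  -- the triples `(j, p, q)` with `p + q + 2j = n` against `(p + j, q + j)` and `j`
  refine Finset.sum_bij' (fun (a : Σ _ : ℕ, ℕ × ℕ) _ =>
      (⟨(a.2.1 + a.1, a.2.2 + a.1), a.1⟩ : Σ _ : ℕ × ℕ, ℕ))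
    (fun (a : Σ _ : ℕ × ℕ, ℕ) _ => (⟨a.2, (a.1.1 - a.2, a.1.2 - a.2)⟩ : Σ _ : ℕ, ℕ × ℕ))
    ?_ ?_ ?_ ?_ ?_
  · rintro ⟨j, p, q⟩ h
    simp only [Finset.mem_sigma, Finset.mem_range, Finset.HasAntidiagonal.mem_antidiagonal] at h ⊢
    omega
  · rintro ⟨⟨k, m⟩, j⟩ h
    simp only [Finset.mem_sigma, Finset.mem_range, Finset.HasAntidiagonal.mem_antidiagonal] at h ⊢
    omega
  · rintro ⟨j, p, q⟩ h
    simp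
  · rintro ⟨⟨k, m⟩, j⟩ h
    simp only [Finset.mem_sigma, Finset.mem_range, Finset.HasAntidiagonal.mem_antidiagonal] at h
    simp only [Sigma.mk.injEq, Prod.mk.injEq, heq_eq_eq, and_true]
    omega
  · rintro ⟨j, p, q⟩ h
    have := gamma_add_pos hα j
    simp only [Nat.add_sub_cancel]
    rw [mul_pow, mul_add 2 p j, mul_add 2 q j, pow_add, pow_add]
    field_simp

lemma pow_mul_gamma_le {α : ℝ} (hα : -(1 / 2) < α) (n : ℕ) :
    (α + 1) ^ n * Real.Gamma (α + 1) ≤ Real.Gamma (n + α + 1) := by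
  induction n with
  | zero => simp
  | succ n ih =>
    rw [gamma_add_succ hα, pow_succ']
    have hn : (0 : ℝ) ≤ n := n.cast_nonneg
    have := gamma_add_pos hα n
    calc (α + 1) * (α + 1) ^ n * Real.Gamma (α + 1)
        = (α + 1) * ((α + 1) ^ n * Real.Gamma (α + 1)) := by ring
      _ ≤ (α + 1) * Real.Gamma (n + α + 1) := by gcongr; linarith
      _ ≤ (n + α + 1) * Real.Gamma (n + α + 1) := by gcongr; linarith

lemma summable_bessel {α : ℝ} (hα : -(1 / 2) < α) {r : ℝ} (hr : 0 ≤ r) :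
    Summable fun n : ℕ => r ^ n / ((n.factorial : ℝ) * Real.Gamma (n + α + 1)) := by
  have hG : 0 < Real.Gamma (α + 1) := Real.Gamma_pos_of_pos (by linarith)
  refine Summable.of_nonneg_of_le (fun n => ?_) (fun n => ?_)
    ((Real.summable_pow_div_factorial (r / (α + 1))).mul_right (Real.Gamma (α + 1))⁻¹)
  · have := gamma_add_pos hα n
    positivity
  · have h1 : 0 < α + 1 := by linarith
    calc r ^ n / ((n.factorial : ℝ) * Real.Gamma (n + α + 1))
        ≤ r ^ n / ((n.factorial : ℝ) * ((α + 1) ^ n * Real.Gamma (α + 1))) := by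
          gcongr
          exact pow_mul_gamma_le hα n
      _ = _ := by rw [div_pow]; field_simp

lemma norm_bessel_term {α : ℝ} (hα : -(1 / 2) < α) (x : ℝ) (n : ℕ) :
    ‖(-1) ^ n / ((n.factorial : ℝ) * Real.Gamma (n + α + 1)) * (x / 2) ^ (2 * n)‖ =
      ((x / 2) ^ 2) ^ n / ((n.factorial : ℝ) * Real.Gamma (n + α + 1)) := by
  have := gamma_add_pos hα n
  rw [norm_mul, norm_div, norm_pow, norm_neg, norm_one, one_pow, Real.norm_of_nonneg
    (by positivity : 0 ≤ (n.factorial : ℝ) * Real.Gamma (n + α + 1)), Real.norm_of_nonneg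
    (by rw [pow_mul]; positivity), pow_mul]
  ring

lemma summable_norm_bessel {α : ℝ} (hα : -(1 / 2) < α) (x : ℝ) :
    Summable fun n : ℕ =>
      ‖(-1) ^ n / ((n.factorial : ℝ) * Real.Gamma (n + α + 1)) * (x / 2) ^ (2 * n)‖ := by
  simp only [norm_bessel_term hα]
  exact summable_bessel hα (by positivity)

lemma hasSum_bessel {α : ℝ} (hα : -(1 / 2) < α) (x : ℝ) :
    HasSum (fun n : ℕ => Real.Gamma (α + 1) *
      ((-1) ^ n / ((n.factorial : ℝ) * Real.Gamma (n + α + 1)) * (x / 2) ^ (2 * n)))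
      (sphericalBessel α x) :=
  (summable_norm_bessel hα x).of_norm.hasSum.mul_left _

/-- Poisson's integral representation. -/
lemma sphericalBessel_eq_integral_cos {α : ℝ} (hα : -(1 / 2) < α) (x : ℝ) :
    sphericalBessel α x = ∫ θ, Real.cos (x * Real.cos θ) ∂(angleMeasure α) := by
  have := isProbabilityMeasure_angleMeasure hα
  have h := hasSum_integral_of_dominated_convergence (μ := angleMeasure α)
    (F := fun (n : ℕ) θ => (-1) ^ n * (x * Real.cos θ) ^ (2 * n) / ((2 * n).factorial : ℝ))
    (f := fun θ => Real.cos (x * Real.cos θ))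
    (fun n _ => |x| ^ (2 * n) / ((2 * n).factorial : ℝ)) (fun n => by fun_prop)
    (fun n => Eventually.of_forall fun θ => by
      rw [norm_div, norm_mul, norm_pow, norm_neg, norm_one, one_pow, one_mul, norm_pow, norm_mul,
        Real.norm_natCast]
      gcongr
      exact mul_le_of_le_one_right (norm_nonneg x) (Real.abs_cos_le_one θ))
    (Eventually.of_forall fun θ => (Real.summable_pow_div_factorial |x|).comp_injective
      (i := fun n => 2 * n) fun a b h => by simpa using h)
    (integrable_const _)
    (Eventually.of_forall fun θ => Real.hasSum_cos _)
  refine (hasSum_bessel hα x).unique ?_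
  convert! h using 2 with n
  have e : ∀ θ : ℝ, (-1) ^ n * (x * Real.cos θ) ^ (2 * n) / ((2 * n).factorial : ℝ) =
      (-1) ^ n * x ^ (2 * n) / ((2 * n).factorial : ℝ) * Real.cos θ ^ (2 * n) := by
    intro θ; rw [mul_pow]; ring
  simp only [e]
  rw [integral_const_mul, moment_cos_even hα, div_pow, pow_mul 2 2 n]
  have := gamma_add_pos hα n
  norm_num
  field_simp

lemma abs_sphericalBessel_le_one {α : ℝ} (hα : -(1 / 2) < α) (x : ℝ) :
    |sphericalBessel α x| ≤ 1 := by
  have := isProbabilityMeasure_angleMeasure hα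
  rw [sphericalBessel_eq_integral_cos hα]
  refine (norm_integral_le_of_norm_le_const (C := 1) (f := fun θ => Real.cos (x * Real.cos θ))
    (Eventually.of_forall fun θ => Real.abs_cos_le_one _)).trans ?_
  simp

lemma continuous_sphericalBessel {α : ℝ} (hα : -(1 / 2) < α) : Continuous (sphericalBessel α) := by
  have := isProbabilityMeasure_angleMeasure hα
  simp only [funext (sphericalBessel_eq_integral_cos hα)]
  exact continuous_of_dominated (bound := fun _ => 1) (fun x => by fun_prop)
    (fun x => Eventually.of_forall fun θ => Real.abs_cos_le_one _) (integrable_const _)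
    (Eventually.of_forall fun θ => by fun_prop)

/-- The product formula: `j_α` is multiplicative under Hankel translation. -/
lemma integral_sphericalBessel_triSide {α : ℝ} (hα : -(1 / 2) < α) (x y ξ : ℝ) :
    ∫ θ, sphericalBessel α (triSide x y θ * ξ) ∂(angleMeasure α) =
      sphericalBessel α (x * ξ) * sphericalBessel α (y * ξ) := by
  have := isProbabilityMeasure_angleMeasure hα
  have hsq : ∀ (θ : ℝ) (n : ℕ), (triSide x y θ * ξ / 2) ^ (2 * n) =
      (((x * ξ) ^ 2 + (y * ξ) ^ 2 + 2 * (x * ξ) * (y * ξ) * Real.cos θ) ^ n) / 4 ^ n := by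
    intro θ n
    rw [pow_mul, ← div_pow]
    congr 1
    linear_combination ξ ^ 2 / 4 * triSide_sq x y θ
  have hb : ∀ θ : ℝ, |(x * ξ) ^ 2 + (y * ξ) ^ 2 + 2 * (x * ξ) * (y * ξ) * Real.cos θ| ≤
      (|x * ξ| + |y * ξ|) ^ 2 := by
    intro θ
    have h1 : |2 * (x * ξ) * (y * ξ) * Real.cos θ| ≤ 2 * |x * ξ| * |y * ξ| := by
      rw [abs_mul, abs_mul, abs_mul, abs_two]
      exact mul_le_of_le_one_right (by positivity) (Real.abs_cos_le_one θ)
    refine (abs_add_le _ _).trans ?_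
    rw [abs_of_nonneg (by positivity : 0 ≤ (x * ξ) ^ 2 + (y * ξ) ^ 2), ← sq_abs (x * ξ),
      ← sq_abs (y * ξ)]
    linarith [show (|x * ξ| + |y * ξ|) ^ 2 = |x * ξ| ^ 2 + |y * ξ| ^ 2 + 2 * |x * ξ| * |y * ξ| by
      ring]
  have h := hasSum_integral_of_dominated_convergence (μ := angleMeasure α)
    (F := fun (n : ℕ) θ => Real.Gamma (α + 1) *
      ((-1) ^ n / ((n.factorial : ℝ) * Real.Gamma (n + α + 1)) *
        (triSide x y θ * ξ / 2) ^ (2 * n)))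
    (f := fun θ => sphericalBessel α (triSide x y θ * ξ))
    (fun n _ => Real.Gamma (α + 1) *
      (((|x * ξ| + |y * ξ|) ^ 2 / 4) ^ n / ((n.factorial : ℝ) * Real.Gamma (n + α + 1))))
    (fun n => by simp only [hsq]; fun_prop)
    (fun n => Eventually.of_forall fun θ => by
      have hG : 0 < Real.Gamma (α + 1) := Real.Gamma_pos_of_pos (by linarith)
      have := gamma_add_pos hα n
      rw [norm_mul, norm_bessel_term hα, Real.norm_of_nonneg hG.le, ← pow_mul, hsq, div_pow _ 4 n]
      gcongr
      · rw [← triSide_sq]; positivity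
      · exact (le_abs_self _).trans (hb θ))
    (Eventually.of_forall fun θ => (summable_bessel hα (by positivity)).mul_left _)
    (integrable_const _)
    (Eventually.of_forall fun θ => hasSum_bessel hα _)
  refine h.unique ?_
  have h2 := tsum_mul_tsum_eq_tsum_sum_antidiagonal_of_summable_norm
    (summable_norm_bessel hα (x * ξ)) (summable_norm_bessel hα (y * ξ))
  have h3 := (summable_norm_sum_mul_antidiagonal_of_summable_norm
    (summable_norm_bessel hα (x * ξ)) (summable_norm_bessel hα (y * ξ))).of_norm.hasSum
  rw [← h2] at h3
  have h4 := h3.mul_left (Real.Gamma (α + 1) ^ 2)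
  convert! h4 using 1
  · ext n
    simp only [hsq]
    rw [integral_const_mul, integral_const_mul, integral_div, integral_triSide_pow hα]
    have hg := gamma_add_pos hα n
    have : ∑ p ∈ Finset.HasAntidiagonal.antidiagonal n,
          (-1) ^ p.1 / ((p.1.factorial : ℝ) * Real.Gamma (p.1 + α + 1)) * (x * ξ / 2) ^ (2 * p.1) *
          ((-1) ^ p.2 / ((p.2.factorial : ℝ) * Real.Gamma (p.2 + α + 1)) *
            (y * ξ / 2) ^ (2 * p.2)) = (-1) ^ n / 4 ^ n *
        ∑ p ∈ Finset.HasAntidiagonal.antidiagonal n,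
          (x * ξ) ^ (2 * p.1) / (p.1.factorial * Real.Gamma (p.1 + α + 1)) *
          ((y * ξ) ^ (2 * p.2) / (p.2.factorial * Real.Gamma (p.2 + α + 1))) := by
      rw [Finset.mul_sum]
      refine Finset.sum_congr rfl fun p hp => ?_
      rw [Finset.HasAntidiagonal.mem_antidiagonal] at hp
      rw [← hp, pow_add, pow_add, div_pow _ 2, div_pow _ 2, pow_mul 2 2, pow_mul 2 2]
      have := gamma_add_pos hα p.1
      have := gamma_add_pos hα p.2
      norm_num
      field_simp
    rw [this]
    field_simp
  · unfold sphericalBessel; ring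

/-! ### The Gaussian and its Hankel transform -/

lemma lintegral_pow_gaussian_mu {α : ℝ} (hα : -(1 / 2) < α) {b : ℝ} (hb : 0 < b) (n : ℕ) :
    ∫⁻ x, ENNReal.ofReal (x ^ (2 * n) * Real.exp (-b * x ^ 2)) ∂(mu α) =
      ENNReal.ofReal ((2 * b) ^ (-(α + 1)) / b ^ n * Real.Gamma (n + α + 1) /
        Real.Gamma (α + 1)) := by
  have hn := norm_const_pos hα
  have hG : 0 < Real.Gamma (α + 1) := Real.Gamma_pos_of_pos (by linarith)
  have hn0 : (0 : ℝ) ≤ n := n.cast_nonneg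
  rw [lintegral_mu]
  have : ∀ x ∈ Ioi (0 : ℝ), ENNReal.ofReal (x ^ (2 * α + 1) / (2 ^ α * Real.Gamma (α + 1))) *
      ENNReal.ofReal (x ^ (2 * n) * Real.exp (-b * x ^ 2)) =
      ENNReal.ofReal ((2 ^ α * Real.Gamma (α + 1))⁻¹) *
      ENNReal.ofReal (x ^ (2 * n + 2 * α + 1) * Real.exp (-b * x ^ (2 : ℝ))) := by
    intro x (hx : 0 < x)
    have := Real.rpow_nonneg (le_of_lt hx) (2 * α + 1)
    rw [← ENNReal.ofReal_mul (by positivity), ← ENNReal.ofReal_mul (by positivity),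
      Real.rpow_two]
    congr 1
    have e : x ^ (2 * (n : ℝ) + 2 * α + 1) = x ^ (2 * α + 1) * x ^ (2 * n) := by
      rw [← Real.rpow_natCast, ← Real.rpow_add hx]; push_cast; congr 1; ring
    rw [e]
    ring
  rw [setLIntegral_congr_fun measurableSet_Ioi this, lintegral_const_mul' _ _ ENNReal.ofReal_ne_top,
    lintegral_rpow_mul_exp two_pos (by linarith) hb, ← ENNReal.ofReal_mul (by positivity)]
  congr 1
  rw [show (2 * n + 2 * α + 1 + 1) / 2 = n + α + 1 by ring,
    show -(2 * n + 2 * α + 1 + 1) / 2 = -(α + 1) - n by ring, Real.rpow_sub_natCast hb.ne',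
    Real.mul_rpow (by norm_num) hb.le, Real.rpow_neg (by norm_num : (0:ℝ) ≤ 2),
    Real.rpow_add_one (by norm_num)]
  field_simp

lemma integrable_pow_gaussian_mu {α : ℝ} (hα : -(1 / 2) < α) {b : ℝ} (hb : 0 < b) (n : ℕ) :
    Integrable (fun x => x ^ (2 * n) * Real.exp (-b * x ^ 2)) (mu α) ∧
      ∫ x, x ^ (2 * n) * Real.exp (-b * x ^ 2) ∂(mu α) =
      (2 * b) ^ (-(α + 1)) / b ^ n * Real.Gamma (n + α + 1) / Real.Gamma (α + 1) := by
  have h := lintegral_pow_gaussian_mu hα hb n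
  have h0 : ∀ x : ℝ, 0 ≤ x ^ (2 * n) * Real.exp (-b * x ^ 2) := fun x => by
    rw [pow_mul]; positivity
  have hG : 0 < Real.Gamma (α + 1) := Real.Gamma_pos_of_pos (by linarith)
  have := gamma_add_pos hα n
  constructor
  · refine ⟨by fun_prop, ?_⟩
    rw [hasFiniteIntegral_iff_ofReal (Eventually.of_forall h0), h]
    exact ENNReal.ofReal_lt_top
  · rw [integral_eq_lintegral_of_nonneg_ae (Eventually.of_forall h0) (by fun_prop), h,
      ENNReal.toReal_ofReal (by positivity)]

lemma integrable_gaussian_mu {α : ℝ} (hα : -(1 / 2) < α) {b : ℝ} (hb : 0 < b) :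
    Integrable (fun x => Real.exp (-b * x ^ 2)) (mu α) := by
  simpa using (integrable_pow_gaussian_mu hα hb 0).1

lemma integral_gaussian_mu {α : ℝ} (hα : -(1 / 2) < α) {b : ℝ} (hb : 0 < b) :
    ∫ x, Real.exp (-b * x ^ 2) ∂(mu α) = (2 * b) ^ (-(α + 1)) := by
  have hG : 0 < Real.Gamma (α + 1) := Real.Gamma_pos_of_pos (by linarith)
  simpa [hG.ne'] using (integrable_pow_gaussian_mu hα hb 0).2

/-- The Hankel transform of a Gaussian is a Gaussian. -/
lemma integral_gaussian_mul_sphericalBessel {α : ℝ} (hα : -(1 / 2) < α) {b : ℝ} (hb : 0 < b)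
    (ξ : ℝ) : ∫ x, Real.exp (-b * x ^ 2) * sphericalBessel α (ξ * x) ∂(mu α) =
      (2 * b) ^ (-(α + 1)) * Real.exp (-ξ ^ 2 / (4 * b)) := by
  have hG : 0 < Real.Gamma (α + 1) := Real.Gamma_pos_of_pos (by linarith)
  have hF : ∀ (n : ℕ) (x : ℝ), Real.exp (-b * x ^ 2) * (Real.Gamma (α + 1) *
      ((-1) ^ n / ((n.factorial : ℝ) * Real.Gamma (n + α + 1)) * (ξ * x / 2) ^ (2 * n))) =
      Real.Gamma (α + 1) * ((-1) ^ n / ((n.factorial : ℝ) * Real.Gamma (n + α + 1)) *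
        (ξ / 2) ^ (2 * n)) * (x ^ (2 * n) * Real.exp (-b * x ^ 2)) := by
    intro n x
    rw [show ξ * x / 2 = (ξ / 2) * x by ring, mul_pow]; ring
  have hI : ∀ n : ℕ, Real.Gamma (α + 1) * (((ξ / 2) ^ 2) ^ n /
      ((n.factorial : ℝ) * Real.Gamma (n + α + 1))) * ((2 * b) ^ (-(α + 1)) / b ^ n *
        Real.Gamma (n + α + 1) / Real.Gamma (α + 1)) =
      (2 * b) ^ (-(α + 1)) * ((ξ ^ 2 / (4 * b)) ^ n / (n.factorial : ℝ)) := by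
    intro n
    have := gamma_add_pos hα n
    rw [show ξ ^ 2 / (4 * b) = (ξ / 2) ^ 2 / b by field_simp; norm_num, div_pow _ b]
    field_simp
  have hnorm : ∀ (n : ℕ) (x : ℝ), ‖Real.exp (-b * x ^ 2) * (Real.Gamma (α + 1) *
      ((-1) ^ n / ((n.factorial : ℝ) * Real.Gamma (n + α + 1)) * (ξ * x / 2) ^ (2 * n)))‖ =
      Real.Gamma (α + 1) * (((ξ / 2) ^ 2) ^ n /
      ((n.factorial : ℝ) * Real.Gamma (n + α + 1))) * (x ^ (2 * n) * Real.exp (-b * x ^ 2)) := by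
    intro n x
    rw [hF, norm_mul, norm_mul, norm_bessel_term hα, Real.norm_of_nonneg hG.le,
      Real.norm_of_nonneg (by rw [pow_mul]; positivity)]
  have h := hasSum_integral_of_summable_integral_norm (μ := mu α)
    (F := fun (n : ℕ) x => Real.exp (-b * x ^ 2) * (Real.Gamma (α + 1) *
      ((-1) ^ n / ((n.factorial : ℝ) * Real.Gamma (n + α + 1)) * (ξ * x / 2) ^ (2 * n))))
    (fun n => by
      simp only [hF]
      exact (integrable_pow_gaussian_mu hα hb n).1.const_mul _)
    (by
      simp only [hnorm, integral_const_mul, (integrable_pow_gaussian_mu hα hb _).2, hI]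
      exact (Real.summable_pow_div_factorial _).mul_left _)
  simp only [((hasSum_bessel hα _).mul_left _).tsum_eq] at h
  refine h.unique ?_
  have he := (NormedSpace.expSeries_div_hasSum_exp (-ξ ^ 2 / (4 * b) : ℝ)).mul_left
    ((2 * b) ^ (-(α + 1)))
  rw [← Real.exp_eq_exp_ℝ] at he
  convert! he using 2 with n
  simp only [hF, integral_const_mul, (integrable_pow_gaussian_mu hα hb _).2]
  have := hI n
  rw [pow_mul, show (-ξ ^ 2 / (4 * b)) ^ n = (-1) ^ n * (ξ ^ 2 / (4 * b)) ^ n by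
    rw [← mul_pow]; congr 1; ring]
  linear_combination (-1) ^ n * this

/-! ### Hankel translation as an operator -/

lemma eLpNorm_two_sq {X E : Type*} [MeasurableSpace X] [NormedAddCommGroup E] (f : X → E)
    (μ : Measure X) : eLpNorm f 2 μ ^ 2 = ∫⁻ x, ‖f x‖ₑ ^ 2 ∂μ := by
  have h := eLpNorm_nnreal_pow_eq_lintegral (f := f) (μ := μ) (p := 2) (by norm_num)
  simpa using h

lemma map_triSide_swap {α : ℝ} (hα : -(1 / 2) < α) (x : ℝ) :
    ((mu α).prod (angleMeasure α)).map (fun p => (triSide x p.1 p.2, p.1)) =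
      ((mu α).prod (angleMeasure α)).map (fun p => (p.1, triSide x p.1 p.2)) := by
  have h0 : Measurable fun p : ℝ × ℝ => triSide x p.1 p.2 :=
    measurable_triSide measurable_const measurable_fst measurable_snd
  have h1 : Measurable fun p : ℝ × ℝ => (triSide x p.1 p.2, p.1) := h0.prodMk measurable_fst
  have h2 : Measurable fun p : ℝ × ℝ => (p.1, triSide x p.1 p.2) := measurable_fst.prodMk h0
  refine Measure.ext_of_lintegral _ fun F hF => ?_
  have m1 : Measurable fun p : ℝ × ℝ => F (triSide x p.1 p.2, p.1) := hF.comp h1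
  have m2 : Measurable fun p : ℝ × ℝ => F (p.1, triSide x p.1 p.2) := hF.comp h2
  rw [lintegral_map hF h1, lintegral_map hF h2, lintegral_prod _ m1.aemeasurable,
    lintegral_prod _ m2.aemeasurable]
  exact lintegral_triSide_swap hα x hF

lemma lintegral_comp_triSide {α : ℝ} (hα : -(1 / 2) < α) (x : ℝ) {G : ℝ → ℝ≥0∞}
    (hG : Measurable G) :
    ∫⁻ y, ∫⁻ θ, G (triSide x y θ) ∂(angleMeasure α) ∂(mu α) = ∫⁻ y, G y ∂(mu α) := by
  rw [lintegral_triSide_swap hα x (F := fun p => G p.1) (hG.comp measurable_fst)]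
  simp [angleMeasure_univ hα]

/-- Null sets stay null under translation, so `translation` is well defined on a.e. classes. -/
lemma ae_ae_triSide {α : ℝ} (hα : -(1 / 2) < α) (x : ℝ) {P : ℝ → Prop}
    (hP : ∀ᵐ y ∂(mu α), P y) :
    ∀ᵐ y ∂(mu α), ∀ᵐ θ ∂(angleMeasure α), P (triSide x y θ) := by
  obtain ⟨s, hs, hsm, hs0⟩ := exists_measurable_superset_of_null (ae_iff.mp hP)
  have h := lintegral_comp_triSide hα x (G := s.indicator 1) (measurable_one.indicator hsm)
  rw [lintegral_indicator_one hsm, hs0, lintegral_eq_zero_iff (by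
    refine Measurable.lintegral_prod_right' (f := fun p : ℝ × ℝ =>
      s.indicator (1 : ℝ → ℝ≥0∞) (triSide x p.1 p.2)) ?_
    exact (measurable_one.indicator hsm).comp
      (measurable_triSide measurable_const measurable_fst measurable_snd))] at h
  filter_upwards [h] with y hy
  have hm : Measurable fun θ => s.indicator (1 : ℝ → ℝ≥0∞) (triSide x y θ) :=
    (measurable_one.indicator hsm).comp
      (measurable_triSide measurable_const measurable_const measurable_id)
  rw [Pi.zero_apply, lintegral_eq_zero_iff hm] at hy
  filter_upwards [hy] with θ hθ
  by_contra hc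
  have : triSide x y θ ∈ s := hs hc
  simp [this] at hθ

lemma translation_congr_ae {α : ℝ} (hα : -(1 / 2) < α) (x : ℝ) {f g : ℝ → ℂ}
    (h : f =ᵐ[mu α] g) : translation α x f =ᵐ[mu α] translation α x g := by
  filter_upwards [ae_ae_triSide hα x h] with y hy
  rw [translation_eq hα, translation_eq hα]
  exact integral_congr_ae hy

lemma translation_comm {α : ℝ} (hα : -(1 / 2) < α) (x y : ℝ) (f : ℝ → ℂ) :
    translation α x f y = translation α y f x := by
  rw [translation_eq hα, translation_eq hα]
  simp only [triSide_comm x y]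

lemma measurable_translation {α : ℝ} (hα : -(1 / 2) < α) {X : Type*} [MeasurableSpace X]
    {f : X → ℝ → ℂ} {u v : X → ℝ} (hf : Measurable fun p : X × ℝ => f p.1 p.2)
    (hu : Measurable u) (hv : Measurable v) :
    Measurable fun p => translation α (u p) (f p) (v p) := by
  simp only [translation_eq hα]
  refine (StronglyMeasurable.integral_prod_right' (ν := angleMeasure α)
    (f := fun q : X × ℝ => f q.1 (triSide (u q.1) (v q.1) q.2)) ?_).measurable
  exact (hf.comp (measurable_fst.prodMk (measurable_triSide (hu.comp measurable_fst)
    (hv.comp measurable_fst) measurable_snd))).stronglyMeasurable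

/-- Jensen's inequality for the angular average. -/
lemma enorm_translation_sq_le {α : ℝ} (hα : -(1 / 2) < α) (x y : ℝ) {f : ℝ → ℂ}
    (hf : Measurable f) :
    ‖translation α x f y‖ₑ ^ 2 ≤ ∫⁻ θ, ‖f (triSide x y θ)‖ₑ ^ 2 ∂(angleMeasure α) := by
  have := isProbabilityMeasure_angleMeasure hα
  have hm : AEStronglyMeasurable (fun θ => f (triSide x y θ)) (angleMeasure α) :=
    (hf.comp (measurable_triSide measurable_const measurable_const
      measurable_id)).aestronglyMeasurable
  rw [← eLpNorm_two_sq, translation_eq hα]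
  gcongr
  calc _ ≤ ∫⁻ θ, ‖f (triSide x y θ)‖ₑ ∂(angleMeasure α) := enorm_integral_le_lintegral_enorm _
    _ = eLpNorm (fun θ => f (triSide x y θ)) 1 (angleMeasure α) :=
      eLpNorm_one_eq_lintegral_enorm.symm
    _ ≤ _ := eLpNorm_le_eLpNorm_of_exponent_le (by norm_num) hm

/-- Hankel translation is a contraction of `L²`. -/
lemma eLpNorm_translation_le {α : ℝ} (hα : -(1 / 2) < α) (x : ℝ) {f : ℝ → ℂ}
    (hf : Measurable f) :
    eLpNorm (translation α x f) 2 (mu α) ≤ eLpNorm f 2 (mu α) := by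
  refine (ENNReal.pow_le_pow_left_iff two_ne_zero).mp ?_
  rw [eLpNorm_two_sq, eLpNorm_two_sq, ← lintegral_comp_triSide hα x
    (G := fun y => ‖f y‖ₑ ^ 2) (by fun_prop)]
  exact lintegral_mono fun y => enorm_translation_sq_le hα x y hf

lemma norm_translation_le {α : ℝ} (hα : -(1 / 2) < α) (x y : ℝ) {f : ℝ → ℂ} {C : ℝ}
    (hC : ∀ y, ‖f y‖ ≤ C) : ‖translation α x f y‖ ≤ C := by
  have := isProbabilityMeasure_angleMeasure hα
  rw [translation_eq hα]
  refine (norm_integral_le_of_norm_le_const (Eventually.of_forall fun θ => hC _)).trans ?_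
  simp

lemma continuous_translation {α : ℝ} (hα : -(1 / 2) < α) {X : Type*} [TopologicalSpace X]
    [FirstCountableTopology X] {f : ℝ → ℂ} {C : ℝ} {u v : X → ℝ}
    (hf : Continuous f) (hC : ∀ y, ‖f y‖ ≤ C) (hu : Continuous u) (hv : Continuous v) :
    Continuous fun p => translation α (u p) f (v p) := by
  have := isProbabilityMeasure_angleMeasure hα
  simp only [translation_eq hα]
  have h : ∀ p : X, Continuous fun θ => f (triSide (u p) (v p) θ) := fun p => by
    unfold triSide; fun_prop
  exact continuous_of_dominated (bound := fun _ => C) (fun p => (h p).aestronglyMeasurable)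
    (fun p => Eventually.of_forall fun θ => hC _) (integrable_const _)
    (Eventually.of_forall fun θ => by unfold triSide; fun_prop)

lemma integrable_prod_fst_mul_triSide {α : ℝ} (hα : -(1 / 2) < α) (x : ℝ) {f h : ℝ → ℂ} {C : ℝ}
    (hf : Integrable f (mu α)) (hh : Measurable h) (hC : ∀ y, ‖h y‖ ≤ C) :
    Integrable (fun p : ℝ × ℝ => f p.1 * h (triSide x p.1 p.2))
      ((mu α).prod (angleMeasure α)) := by
  have := isProbabilityMeasure_angleMeasure hα
  refine (hf.comp_fst (angleMeasure α)).mul_bdd (c := C) ?_ (Eventually.of_forall fun _ => hC _)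
  exact (hh.comp (measurable_triSide measurable_const measurable_fst
    measurable_snd)).aestronglyMeasurable

/-- Hankel translation is symmetric with respect to `mu α`. -/
lemma integral_translation_mul {α : ℝ} (hα : -(1 / 2) < α) (x : ℝ) {f h : ℝ → ℂ} {C : ℝ}
    (hfm : Measurable f) (hf : Integrable f (mu α)) (hh : Measurable h) (hC : ∀ y, ‖h y‖ ≤ C) :
    ∫ y, translation α x f y * h y ∂(mu α) = ∫ y, f y * translation α x h y ∂(mu α) := by
  have h0 : Measurable fun p : ℝ × ℝ => triSide x p.1 p.2 :=
    measurable_triSide measurable_const measurable_fst measurable_snd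
  have h1 : Measurable fun p : ℝ × ℝ => (triSide x p.1 p.2, p.1) := h0.prodMk measurable_fst
  have h2 : Measurable fun p : ℝ × ℝ => (p.1, triSide x p.1 p.2) := measurable_fst.prodMk h0
  have hF : Measurable fun q : ℝ × ℝ => f q.1 * h q.2 := by fun_prop
  have i2 := integrable_prod_fst_mul_triSide hα x hf hh hC
  have i1 : Integrable (fun p : ℝ × ℝ => f (triSide x p.1 p.2) * h p.1)
      ((mu α).prod (angleMeasure α)) := by
    have := (integrable_map_measure (f := fun p : ℝ × ℝ => (p.1, triSide x p.1 p.2))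
      hF.aestronglyMeasurable h2.aemeasurable).mpr i2
    rw [← map_triSide_swap hα] at this
    exact (integrable_map_measure hF.aestronglyMeasurable h1.aemeasurable).mp this
  simp only [translation_eq hα, ← integral_mul_const, ← integral_const_mul]
  rw [← integral_prod _ i1, ← integral_prod _ i2]
  have e := congrArg (fun m => ∫ q, f q.1 * h q.2 ∂m) (map_triSide_swap hα x)
  rwa [integral_map h1.aemeasurable hF.aestronglyMeasurable,
    integral_map h2.aemeasurable hF.aestronglyMeasurable] at e

/-! ### Dilations -/

lemma lintegral_mu_comp_mul {α a : ℝ} (hα : -(1 / 2) < α) (ha : 0 < a) (F : ℝ → ℝ≥0∞) :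
    ∫⁻ x, F (a * x) ∂(mu α) = ENNReal.ofReal (a ^ (-(2 * α + 2))) * ∫⁻ x, F x ∂(mu α) := by
  have hn := norm_const_pos hα
  have h := lintegral_image_eq_lintegral_abs_deriv_mul (s := Ioi (0 : ℝ)) measurableSet_Ioi
    (f := fun x => a * x) (f' := fun _ => a)
    (fun x _ => by simpa using ((hasDerivAt_id x).const_mul a).hasDerivWithinAt)
    (fun x _ y _ h => mul_left_cancel₀ ha.ne' h)
    (fun x => ENNReal.ofReal (x ^ (2 * α + 1) / (2 ^ α * Real.Gamma (α + 1))) * F x)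
  rw [image_mul_left_Ioi ha, mul_zero] at h
  rw [lintegral_mu, lintegral_mu, h, ← lintegral_const_mul' _ _ ENNReal.ofReal_ne_top]
  refine setLIntegral_congr_fun measurableSet_Ioi fun x (hx : 0 < x) => ?_
  rw [← mul_assoc, ← mul_assoc, abs_of_pos ha, ← ENNReal.ofReal_mul (by positivity),
    ← ENNReal.ofReal_mul (by positivity)]
  congr 2
  rw [Real.mul_rpow ha.le hx.le, Real.rpow_neg ha.le,
    show 2 * α + 2 = 2 * α + 1 + 1 by ring, Real.rpow_add_one ha.ne']
  field_simp

lemma map_mul_mu {α a : ℝ} (hα : -(1 / 2) < α) (ha : 0 < a) :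
    (mu α).map (fun x => a * x) = ENNReal.ofReal (a ^ (-(2 * α + 2))) • mu α := by
  refine Measure.ext_of_lintegral _ fun F hF => ?_
  rw [lintegral_map hF (by fun_prop), lintegral_mu_comp_mul hα ha, lintegral_smul_measure,
    smul_eq_mul]

lemma integral_mu_comp_mul {E : Type*} [NormedAddCommGroup E] [NormedSpace ℝ E]
    {α a : ℝ} (hα : -(1 / 2) < α) (ha : 0 < a) (F : ℝ → E) :
    ∫ x, F (a * x) ∂(mu α) = a ^ (-(2 * α + 2)) • ∫ x, F x ∂(mu α) := by
  rw [← (measurableEmbedding_mulLeft₀ ha.ne').integral_map, map_mul_mu hα ha,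
    integral_smul_measure, ENNReal.toReal_ofReal (by positivity)]

lemma ae_mu_comp_mul {α a : ℝ} (hα : -(1 / 2) < α) (ha : 0 < a) {P : ℝ → Prop}
    (hP : ∀ᵐ x ∂(mu α), P x) : ∀ᵐ x ∂(mu α), P (a * x) := by
  have h : ∀ᵐ x ∂(mu α).map (fun x => a * x), P x := by
    rw [map_mul_mu hα ha]
    exact Measure.ae_smul_measure hP _
  exact ae_of_ae_map (by fun_prop) h

lemma dilation_congr_ae {α a : ℝ} (hα : -(1 / 2) < α) (ha : 0 < a) {f g : ℝ → ℂ}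
    (h : f =ᵐ[mu α] g) : dilation α a f =ᵐ[mu α] dilation α a g := by
  filter_upwards [ae_mu_comp_mul hα ha h] with x hx
  simp only [dilation, hx]

lemma integrable_dilation {α a : ℝ} (hα : -(1 / 2) < α) (ha : 0 < a) {f : ℝ → ℂ}
    (hf : Integrable f (mu α)) : Integrable (dilation α a f) (mu α) := by
  refine Integrable.const_mul ?_ _
  have := (measurableEmbedding_mulLeft₀ ha.ne').integrable_map_iff (μ := mu α) (g := f)
  exact this.mp (by rw [map_mul_mu hα ha]; exact hf.smul_measure ENNReal.ofReal_ne_top)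

/-- The dilations are normalised to be isometries of `L²`. -/
lemma eLpNorm_dilation {α a : ℝ} (hα : -(1 / 2) < α) (ha : 0 < a) (f : ℝ → ℂ) :
    eLpNorm (dilation α a f) 2 (mu α) = eLpNorm f 2 (mu α) := by
  refine (ENNReal.pow_right_strictMono two_ne_zero).injective ?_
  simp only [eLpNorm_two_sq, dilation, enorm_mul, mul_pow]
  rw [lintegral_const_mul' _ _ (by simp), lintegral_mu_comp_mul hα ha (fun y => ‖f y‖ₑ ^ 2),
    ← mul_assoc, ← ofReal_norm, Complex.norm_real,
    Real.norm_of_nonneg (by positivity),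
    ← ENNReal.ofReal_pow (by positivity), ← ENNReal.ofReal_mul (by positivity),
    ← Real.rpow_mul_natCast ha.le, ← Real.rpow_add ha]
  have : (α + 1) * ((2 : ℕ) : ℝ) + -(2 * α + 2) = 0 := by push_cast; ring
  rw [this]; simp

/-! ### The Hankel transform -/

lemma norm_sphericalBessel_le_one {α : ℝ} (hα : -(1 / 2) < α) (x : ℝ) :
    ‖(sphericalBessel α x : ℂ)‖ ≤ 1 := by
  rw [Complex.norm_real]; exact abs_sphericalBessel_le_one hα x

lemma continuous_ofReal_sphericalBessel {α : ℝ} (hα : -(1 / 2) < α) :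
    Continuous fun x => (sphericalBessel α x : ℂ) :=
  Complex.continuous_ofReal.comp (continuous_sphericalBessel hα)

lemma translation_sphericalBessel {α : ℝ} (hα : -(1 / 2) < α) (x y ξ : ℝ) :
    translation α x (fun y => (sphericalBessel α (y * ξ) : ℂ)) y =
      sphericalBessel α (x * ξ) * sphericalBessel α (y * ξ) := by
  rw [translation_eq hα, integral_complex_ofReal, integral_sphericalBessel_triSide hα,
    Complex.ofReal_mul]

lemma hankel_congr_ae {α : ℝ} {f g : ℝ → ℂ} (h : f =ᵐ[mu α] g) : hankel α f = hankel α g := by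
  ext ξ
  refine integral_congr_ae ?_
  filter_upwards [h] with x hx
  rw [hx]

lemma integrable_mul_sphericalBessel {α : ℝ} (hα : -(1 / 2) < α) {f : ℝ → ℂ}
    (hf : Integrable f (mu α)) (ξ : ℝ) :
    Integrable (fun x => f x * (sphericalBessel α (x * ξ) : ℂ)) (mu α) :=
  hf.mul_bdd (c := 1) ((continuous_ofReal_sphericalBessel hα).comp
    (by fun_prop)).aestronglyMeasurable
    (Eventually.of_forall fun _ => norm_sphericalBessel_le_one hα _)

lemma continuous_hankel {α : ℝ} (hα : -(1 / 2) < α) {f : ℝ → ℂ} (hf : Integrable f (mu α)) :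
    Continuous (hankel α f) := by
  refine continuous_of_dominated (bound := fun x => ‖f x‖)
    (fun ξ => (integrable_mul_sphericalBessel hα hf ξ).aestronglyMeasurable)
    (fun ξ => Eventually.of_forall fun x => ?_) hf.norm (Eventually.of_forall fun x => ?_)
  · rw [norm_mul]
    exact mul_le_of_le_one_right (norm_nonneg _) (norm_sphericalBessel_le_one hα _)
  · exact continuous_const.mul ((continuous_ofReal_sphericalBessel hα).comp (by fun_prop))

lemma norm_hankel_le {α : ℝ} (hα : -(1 / 2) < α) {f : ℝ → ℂ} (hf : Integrable f (mu α)) (ξ : ℝ) :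
    ‖hankel α f ξ‖ ≤ ∫ x, ‖f x‖ ∂(mu α) := by
  refine norm_integral_le_of_norm_le hf.norm (Eventually.of_forall fun x => ?_)
  rw [norm_mul]
  exact mul_le_of_le_one_right (norm_nonneg _) (norm_sphericalBessel_le_one hα _)

lemma hankel_conj (α : ℝ) (f : ℝ → ℂ) (ξ : ℝ) :
    hankel α (fun x => starRingEnd ℂ (f x)) ξ = starRingEnd ℂ (hankel α f ξ) := by
  unfold hankel
  rw [← integral_conj]
  simp

lemma hankel_translation {α : ℝ} (hα : -(1 / 2) < α) {f : ℝ → ℂ} (hfm : Measurable f)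
    (hf : Integrable f (mu α)) (t ξ : ℝ) :
    hankel α (translation α t f) ξ = sphericalBessel α (t * ξ) * hankel α f ξ := by
  unfold hankel
  rw [integral_translation_mul (h := fun y => (sphericalBessel α (y * ξ) : ℂ)) hα t hfm hf
    ((continuous_ofReal_sphericalBessel hα).comp
    (by fun_prop : Continuous fun y : ℝ => y * ξ)).measurable
    (fun y => norm_sphericalBessel_le_one hα _), ← integral_const_mul]
  simp only [translation_sphericalBessel hα]
  congr 1; ext x; ring

lemma hankel_dilation {α a : ℝ} (hα : -(1 / 2) < α) (ha : 0 < a) (f : ℝ → ℂ) (ξ : ℝ) :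
    hankel α (dilation α a f) ξ = ((a ^ (-(α + 1)) : ℝ) : ℂ) * hankel α f (ξ / a) := by
  unfold hankel dilation
  have e : ∀ x : ℝ, ((a ^ (α + 1) : ℝ) : ℂ) * f (a * x) * (sphericalBessel α (x * ξ) : ℂ) =
      (fun y => ((a ^ (α + 1) : ℝ) : ℂ) * (f y * (sphericalBessel α (y * (ξ / a)) : ℂ)))
        (a * x) := by
    intro x
    simp only
    rw [show a * x * (ξ / a) = x * ξ by field_simp, mul_assoc]
  simp only [e]
  rw [integral_mu_comp_mul hα ha (fun y => ((a ^ (α + 1) : ℝ) : ℂ) *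
    (f y * (sphericalBessel α (y * (ξ / a)) : ℂ))), integral_const_mul, Complex.real_smul,
    ← mul_assoc, ← Complex.ofReal_mul, ← Real.rpow_add ha]
  congr 3; ring

/-- The Hankel transform is symmetric. -/
lemma integral_hankel_mul {α : ℝ} (hα : -(1 / 2) < α) {f h : ℝ → ℂ}
    (hf : Integrable f (mu α)) (hh : Integrable h (mu α)) :
    ∫ ξ, hankel α f ξ * h ξ ∂(mu α) = ∫ x, f x * hankel α h x ∂(mu α) := by
  unfold hankel
  simp only [← integral_mul_const, ← integral_const_mul]
  rw [integral_integral_swap]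
  · congr 1; ext x; congr 1; ext ξ
    rw [mul_comm ξ x]; ring
  · have : Integrable (fun p : ℝ × ℝ => h p.1 * f p.2 * (sphericalBessel α (p.2 * p.1) : ℂ))
        ((mu α).prod (mu α)) :=
      (hh.mul_prod hf).mul_bdd (c := 1) ((continuous_ofReal_sphericalBessel hα).comp
        (by fun_prop)).aestronglyMeasurable
        (Eventually.of_forall fun _ => norm_sphericalBessel_le_one hα _)
    refine this.congr (Eventually.of_forall fun p => ?_)
    simp only [Function.uncurry]; ring

/-! ### Plancherel's theorem -/

lemma integrable_ofReal_gaussian {α : ℝ} (hα : -(1 / 2) < α) {b : ℝ} (hb : 0 < b) :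
    Integrable (fun x => ((Real.exp (-b * x ^ 2) : ℝ) : ℂ)) (mu α) :=
  (integrable_gaussian_mu hα hb).ofReal

lemma hankel_gaussian {α : ℝ} (hα : -(1 / 2) < α) {b : ℝ} (hb : 0 < b) (ξ : ℝ) :
    hankel α (fun x => ((Real.exp (-b * x ^ 2) : ℝ) : ℂ)) ξ =
      (((2 * b) ^ (-(α + 1)) * Real.exp (-ξ ^ 2 / (4 * b)) : ℝ) : ℂ) := by
  rw [← integral_gaussian_mul_sphericalBessel hα hb, ← integral_complex_ofReal]
  unfold hankel
  simp only [Complex.ofReal_mul, mul_comm ξ]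

/-- Modulation by a Bessel function corresponds to translation of the Hankel transform. -/
lemma translation_hankel {α : ℝ} (hα : -(1 / 2) < α) {u : ℝ → ℂ} (hu : Integrable u (mu α))
    (x y : ℝ) : translation α x (hankel α u) y =
      hankel α (fun ξ => u ξ * (sphericalBessel α (x * ξ) : ℂ)) y := by
  have := isProbabilityMeasure_angleMeasure hα
  rw [translation_eq hα]
  unfold hankel
  rw [integral_integral_swap]
  · congr 1; ext ξ
    rw [integral_const_mul, mul_assoc]
    congr 1
    have h := translation_sphericalBessel hα x y ξ
    rw [translation_eq hα] at h
    simp only [mul_comm ξ]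
    exact h
  · have : Integrable (fun p : ℝ × ℝ => u p.2 *
        (sphericalBessel α (p.2 * triSide x y p.1) : ℂ)) ((angleMeasure α).prod (mu α)) := by
      refine (hu.comp_snd (angleMeasure α)).mul_bdd (c := 1) ?_
        (Eventually.of_forall fun _ => norm_sphericalBessel_le_one hα _)
      refine ((continuous_ofReal_sphericalBessel hα).measurable.comp
        (measurable_snd.mul ?_)).aestronglyMeasurable
      exact measurable_triSide measurable_const measurable_const measurable_fst
    exact this

/-- Inverting a Gaussian-damped Hankel transform gives an average of translates against a
rescaled Gaussian. -/
lemma hankel_hankel_mul_gaussian {α : ℝ} (hα : -(1 / 2) < α) {f : ℝ → ℂ} (hfm : Measurable f)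
    (hf : Integrable f (mu α)) {c : ℝ} (hc : 0 < c) (x : ℝ) :
    hankel α (fun ξ => hankel α f ξ * ((Real.exp (-(c ^ 2 / 2) * ξ ^ 2) : ℝ) : ℂ)) x =
      ∫ r, translation α x f (c * r) * ((Real.exp (-(1 / 2) * r ^ 2) : ℝ) : ℂ) ∂(mu α) := by
  have hb : 0 < c ^ 2 / 2 := by positivity
  set u : ℝ → ℂ := fun ξ => ((Real.exp (-(c ^ 2 / 2) * ξ ^ 2) : ℝ) : ℂ) with hu
  have hui : Integrable u (mu α) := integrable_ofReal_gaussian hα hb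
  have huh : ∀ y, hankel α u y =
      (((c ^ 2) ^ (-(α + 1)) * Real.exp (-y ^ 2 / (2 * c ^ 2)) : ℝ) : ℂ) := by
    intro y
    rw [hu, hankel_gaussian hα hb]
    rw [show 2 * (c ^ 2 / 2) = c ^ 2 by ring, show 4 * (c ^ 2 / 2) = 2 * c ^ 2 by ring]
  have hint : Integrable (fun ξ => u ξ * (sphericalBessel α (x * ξ) : ℂ)) (mu α) := by
    simpa only [mul_comm x] using integrable_mul_sphericalBessel hα hui x
  have e1 : hankel α (fun ξ => hankel α f ξ * u ξ) x =
      ∫ ξ, hankel α f ξ * (u ξ * (sphericalBessel α (x * ξ) : ℂ)) ∂(mu α) := by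
    unfold hankel
    simp only [mul_comm x, mul_assoc]
  rw [e1, integral_hankel_mul hα hf hint]
  simp only [← translation_hankel hα hui]
  rw [← integral_translation_mul hα x hfm hf (continuous_hankel hα hui).measurable
    (norm_hankel_le hα hui)]
  have e2 := integral_mu_comp_mul hα hc (fun y => translation α x f y * hankel α u y)
  rw [← inv_smul_eq_iff₀ (by positivity)] at e2
  rw [← e2, ← integral_smul]
  congr 1; ext r
  rw [huh, Complex.real_smul, mul_left_comm, ← Complex.ofReal_mul]
  congr 2
  rw [← Real.rpow_natCast, ← Real.rpow_mul hc.le, ← mul_assoc, ← Real.rpow_neg hc.le,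
    ← Real.rpow_add hc]
  have h0 : -(-(2 * α + 2)) + ((2 : ℕ) : ℝ) * (-(α + 1)) = 0 := by push_cast; ring
  rw [h0, Real.rpow_zero, one_mul]
  congr 1
  rw [Real.rpow_natCast]
  field_simp

lemma integral_norm_hankel_sq_mul_gaussian {α : ℝ} (hα : -(1 / 2) < α) {g : ℝ → ℂ}
    (hgm : Measurable g) (hg : Integrable g (mu α)) {c : ℝ} (hc : 0 < c) :
    ((∫ ξ, ‖hankel α g ξ‖ ^ 2 * Real.exp (-(c ^ 2 / 2) * ξ ^ 2) ∂(mu α) : ℝ) : ℂ) =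
      ∫ x, g x * ∫ r, translation α x (fun y => starRingEnd ℂ (g y)) (c * r) *
        ((Real.exp (-(1 / 2) * r ^ 2) : ℝ) : ℂ) ∂(mu α) ∂(mu α) := by
  have hb : 0 < c ^ 2 / 2 := by positivity
  have hcm : Measurable fun y => starRingEnd ℂ (g y) := Complex.continuous_conj.measurable.comp hgm
  have hci : Integrable (fun y => starRingEnd ℂ (g y)) (mu α) :=
    hg.congr' hcm.aestronglyMeasurable (Eventually.of_forall fun y => (RCLike.norm_conj _).symm)
  simp only [← hankel_hankel_mul_gaussian hα hcm hci hc]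
  rw [← integral_hankel_mul hα hg, ← integral_complex_ofReal]
  · congr 1; ext ξ
    rw [hankel_conj, ← mul_assoc, Complex.mul_conj, Complex.normSq_eq_norm_sq, Complex.ofReal_mul]
  · exact (integrable_ofReal_gaussian hα hb).bdd_mul (c := ∫ x, ‖starRingEnd ℂ (g x)‖ ∂(mu α))
      (continuous_hankel hα hci).aestronglyMeasurable
      (Eventually.of_forall fun _ => norm_hankel_le hα hci _)

lemma tendsto_gaussian_average {α : ℝ} (hα : -(1 / 2) < α) {f : ℝ → ℂ} {C : ℝ}
    (hf : Continuous f) (hC : ∀ y, ‖f y‖ ≤ C) {x : ℝ} (hx : 0 ≤ x) {c : ℕ → ℝ}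
    (hc : Tendsto c atTop (𝓝 0)) :
    Tendsto (fun n => ∫ r, translation α x f (c n * r) *
      ((Real.exp (-(1 / 2) * r ^ 2) : ℝ) : ℂ) ∂(mu α)) atTop (𝓝 (f x)) := by
  have := isProbabilityMeasure_angleMeasure hα
  have ht : Continuous fun y => translation α x f y :=
    continuous_translation hα hf hC continuous_const continuous_id
  have h0 : translation α x f 0 = f x := by
    rw [translation_eq hα]
    simp [triSide_zero_right hx]
  have h1 : ∫ r, f x * ((Real.exp (-(1 / 2) * r ^ 2) : ℝ) : ℂ) ∂(mu α) = f x := by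
    rw [integral_const_mul, integral_complex_ofReal, integral_gaussian_mu hα (by norm_num)]
    simp
  rw [← h1]
  refine tendsto_integral_of_dominated_convergence
    (fun r => C * Real.exp (-(1 / 2) * r ^ 2)) (fun n => ?_)
    ((integrable_gaussian_mu hα (by norm_num)).const_mul C) (fun n => ?_) ?_
  · refine Continuous.aestronglyMeasurable ?_
    exact (ht.comp (by fun_prop)).mul (by fun_prop)
  · refine Eventually.of_forall fun r => ?_
    rw [norm_mul, Complex.norm_real, Real.norm_of_nonneg (Real.exp_pos _).le]
    gcongr
    exact norm_translation_le hα _ _ hC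
  · refine Eventually.of_forall fun r => Tendsto.mul_const _ ?_
    have h2 : Tendsto (fun n => c n * r) atTop (𝓝 0) := by simpa using hc.mul_const r
    rw [← h0]
    exact (ht.tendsto 0).comp h2

/-- Plancherel's theorem for the Hankel transform, on bounded continuous integrable functions. -/
lemma lintegral_hankel_sq {α : ℝ} (hα : -(1 / 2) < α) {g : ℝ → ℂ} {C : ℝ}
    (hgc : Continuous g) (hC : ∀ y, ‖g y‖ ≤ C) (hg : Integrable g (mu α)) :
    ∫⁻ ξ, ‖hankel α g ξ‖ₑ ^ 2 ∂(mu α) = ∫⁻ x, ‖g x‖ₑ ^ 2 ∂(mu α) := by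
  set c : ℕ → ℝ := fun n => 1 / ((n : ℝ) + 1) with hc
  have hcpos : ∀ n, 0 < c n := fun n => by positivity
  have hclim : Tendsto c atTop (𝓝 0) := tendsto_one_div_add_atTop_nhds_zero_nat
  have hcanti : Antitone c := fun m n h => by
    simp only [hc]; gcongr
  have hconj : Continuous fun y => starRingEnd ℂ (g y) := Complex.continuous_conj.comp hgc
  have hconjC : ∀ y, ‖starRingEnd ℂ (g y)‖ ≤ C := fun y => by rw [RCLike.norm_conj]; exact hC y
  have hgsq : Integrable (fun x => ‖g x‖ ^ 2) (mu α) := by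
    simp only [sq]
    exact hg.norm.mul_bdd (c := C) hg.norm.aestronglyMeasurable
      (Eventually.of_forall fun x => by rw [norm_norm]; exact hC x)
  have hhc := continuous_hankel hα hg
  have hb : ∀ n, 0 < c n ^ 2 / 2 := fun n => by have := hcpos n; positivity
  have hint : ∀ n, Integrable (fun ξ => ‖hankel α g ξ‖ ^ 2 * Real.exp (-(c n ^ 2 / 2) * ξ ^ 2))
      (mu α) := fun n =>
    (integrable_gaussian_mu hα (hb n)).bdd_mul (c := (∫ x, ‖g x‖ ∂(mu α)) ^ 2)
      (hhc.norm.pow 2).aestronglyMeasurable (Eventually.of_forall fun ξ => by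
        rw [norm_pow, norm_norm]; gcongr; exact norm_hankel_le hα hg ξ)
  -- the damped energies increase to the energy of the transform
  have lim1 : Tendsto (fun n => ENNReal.ofReal
      (∫ ξ, ‖hankel α g ξ‖ ^ 2 * Real.exp (-(c n ^ 2 / 2) * ξ ^ 2) ∂(mu α))) atTop
      (𝓝 (∫⁻ ξ, ‖hankel α g ξ‖ₑ ^ 2 ∂(mu α))) := by
    have e : ∀ n, ENNReal.ofReal
      (∫ ξ, ‖hankel α g ξ‖ ^ 2 * Real.exp (-(c n ^ 2 / 2) * ξ ^ 2) ∂(mu α)) =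
      ∫⁻ ξ, ENNReal.ofReal (‖hankel α g ξ‖ ^ 2 * Real.exp (-(c n ^ 2 / 2) * ξ ^ 2)) ∂(mu α) :=
      fun n => ofReal_integral_eq_lintegral_ofReal (hint n)
        (Eventually.of_forall fun ξ => by positivity)
    simp only [e]
    refine lintegral_tendsto_of_tendsto_of_monotone (fun n => by fun_prop)
      (Eventually.of_forall fun ξ m n h => ?_) (Eventually.of_forall fun ξ => ?_)
    · have := hcanti h
      have := hcpos n
      dsimp only
      gcongr
    · rw [← ofReal_norm, ← ENNReal.ofReal_pow (norm_nonneg _)]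
      refine (ENNReal.continuous_ofReal.tendsto _).comp ?_
      have : Tendsto (fun n => ‖hankel α g ξ‖ ^ 2 * Real.exp (-(c n ^ 2 / 2) * ξ ^ 2)) atTop
          (𝓝 (‖hankel α g ξ‖ ^ 2 * Real.exp (-(0 ^ 2 / 2) * ξ ^ 2))) :=
        (((((hclim.pow 2).div_const 2).neg).mul_const (ξ ^ 2)).rexp).const_mul _
      simpa using this
  -- by the heat kernel identity they also tend to the energy of the function
  have lim2 : Tendsto (fun n =>
      ((∫ ξ, ‖hankel α g ξ‖ ^ 2 * Real.exp (-(c n ^ 2 / 2) * ξ ^ 2) ∂(mu α) : ℝ) : ℂ)) atTop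
      (𝓝 (∫ x, g x * starRingEnd ℂ (g x) ∂(mu α))) := by
    simp only [integral_norm_hankel_sq_mul_gaussian hα hgc.measurable hg (hcpos _)]
    refine tendsto_integral_of_dominated_convergence
      (fun x => ‖g x‖ * C) (fun n => ?_) (hg.norm.mul_const C) (fun n => ?_) ?_
    · refine hgc.aestronglyMeasurable.mul ?_
      refine (StronglyMeasurable.integral_prod_right' (f := fun p : ℝ × ℝ =>
        translation α p.1 (fun y => starRingEnd ℂ (g y)) (c n * p.2) *
          ((Real.exp (-(1 / 2) * p.2 ^ 2) : ℝ) : ℂ)) ?_).aestronglyMeasurable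
      refine Continuous.stronglyMeasurable ?_
      exact (continuous_translation hα hconj hconjC continuous_fst
        (continuous_const.mul continuous_snd)).mul (by fun_prop)
    · refine Eventually.of_forall fun x => ?_
      rw [norm_mul]
      gcongr
      refine (norm_integral_le_of_norm_le (g := fun r => C * Real.exp (-(1 / 2) * r ^ 2))
        ((integrable_gaussian_mu hα (by norm_num)).const_mul C)
        (Eventually.of_forall fun r => ?_)).trans ?_
      · rw [norm_mul, Complex.norm_real, Real.norm_of_nonneg (Real.exp_pos _).le]
        gcongr
        exact norm_translation_le hα _ _ hconjC
      · rw [integral_const_mul, integral_gaussian_mu hα (by norm_num)]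
        simp
    · filter_upwards [ae_mu_pos α] with x hx
      exact (tendsto_gaussian_average hα hconj hconjC hx.le hclim).const_mul _
  have e3 : ∫ x, g x * starRingEnd ℂ (g x) ∂(mu α) = ((∫ x, ‖g x‖ ^ 2 ∂(mu α) : ℝ) : ℂ) := by
    rw [← integral_complex_ofReal]
    simp only [Complex.mul_conj, Complex.normSq_eq_norm_sq]
  rw [e3] at lim2
  have lim3 := (ENNReal.continuous_ofReal.tendsto _).comp
    ((Complex.continuous_re.tendsto _).comp lim2)
  refine (tendsto_nhds_unique lim1 lim3).trans ?_
  rw [Complex.ofReal_re, ofReal_integral_eq_lintegral_ofReal hgsq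
    (Eventually.of_forall fun x => by positivity)]
  simp only [← ofReal_norm, ENNReal.ofReal_pow (norm_nonneg _)]

/-! ### Generalised convolution -/

lemma integrable_mul_translation {α : ℝ} (hα : -(1 / 2) < α) {f φ : ℝ → ℂ} (hfm : Measurable f)
    (hf : Integrable f (mu α)) (hφm : Measurable φ) (hφ : Integrable φ (mu α)) :
    Integrable (fun p : ℝ × ℝ => f p.2 * translation α p.1 φ p.2) ((mu α).prod (mu α)) := by
  have hm : Measurable fun p : ℝ × ℝ => f p.2 * translation α p.1 φ p.2 :=
    (hfm.comp measurable_snd).mul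
      (measurable_translation hα (hφm.comp measurable_snd) measurable_fst measurable_snd)
  refine ⟨hm.aestronglyMeasurable, ?_⟩
  rw [hasFiniteIntegral_iff_enorm, lintegral_prod_symm _ hm.enorm.aemeasurable]
  calc _ ≤ ∫⁻ t, ‖f t‖ₑ * ∫⁻ x, ‖φ x‖ₑ ∂(mu α) ∂(mu α) := by
        refine lintegral_mono fun t => ?_
        simp only [enorm_mul]
        rw [lintegral_const_mul' _ _ enorm_ne_top]
        refine mul_le_mul_right ?_ _
        rw [← lintegral_comp_triSide hα t (G := fun y => ‖φ y‖ₑ) (by fun_prop)]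
        refine lintegral_mono fun x => ?_
        rw [translation_comm hα, translation_eq hα]
        exact enorm_integral_le_lintegral_enorm _
    _ < ∞ := by
        rw [lintegral_mul_const _ (by fun_prop)]
        exact ENNReal.mul_lt_top hf.2 hφ.2

/-- The Hankel transform turns generalised convolution into multiplication. -/
lemma hankel_convolution {α : ℝ} (hα : -(1 / 2) < α) {f φ : ℝ → ℂ} (hfm : Measurable f)
    (hf : Integrable f (mu α)) (hφm : Measurable φ) (hφ : Integrable φ (mu α)) (ξ : ℝ) :
    hankel α (fun x => ∫ t, f t * translation α x φ t ∂(mu α)) ξ =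
      hankel α f ξ * hankel α φ ξ := by
  have hint := integrable_mul_translation hα hfm hf hφm hφ
  have h1 : ∀ t, ∫ x, f t * translation α x φ t * (sphericalBessel α (x * ξ) : ℂ) ∂(mu α) =
      f t * (sphericalBessel α (t * ξ) : ℂ) * hankel α φ ξ := by
    intro t
    rw [mul_assoc (f t), ← hankel_translation hα hφm hφ, hankel, ← integral_const_mul]
    simp only [translation_comm hα t, mul_assoc]
  unfold hankel at h1 ⊢
  simp only [← integral_mul_const]
  rw [integral_integral_swap]
  · simp only [h1, integral_mul_const]
  · exact hint.mul_bdd (c := 1) ((continuous_ofReal_sphericalBessel hα).comp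
        (by fun_prop)).aestronglyMeasurable
        (Eventually.of_forall fun _ => norm_sphericalBessel_le_one hα _)

lemma lintegral_convolution_sq {α : ℝ} (hα : -(1 / 2) < α) {f φ : ℝ → ℂ} {C : ℝ}
    (hfc : Continuous f) (hC : ∀ y, ‖f y‖ ≤ C)
    (hf : Integrable f (mu α)) (hφm : Measurable φ) (hφ : Integrable φ (mu α)) :
    ∫⁻ x, ‖∫ t, f t * translation α x φ t ∂(mu α)‖ₑ ^ 2 ∂(mu α) =
      ∫⁻ ξ, ‖hankel α f ξ‖ₑ ^ 2 * ‖hankel α φ ξ‖ₑ ^ 2 ∂(mu α) := by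
  have e : ∀ x, ∫ t, f t * translation α x φ t ∂(mu α) =
      ∫ t, φ t * translation α x f t ∂(mu α) := by
    intro x
    rw [← integral_translation_mul hα x hφm hφ hfc.measurable hC]
    simp only [mul_comm]
  have hbd : ∀ x t, ‖φ t * translation α x f t‖ ≤ ‖φ t‖ * C := fun x t => by
    rw [norm_mul]; gcongr; exact norm_translation_le hα _ _ hC
  have hcont : Continuous fun x => ∫ t, f t * translation α x φ t ∂(mu α) := by
    simp only [e]
    have h1 : ∀ x, Continuous fun t => translation α x f t := fun x =>
      continuous_translation hα hfc hC continuous_const continuous_id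
    have h2 : ∀ t, Continuous fun x => translation α x f t := fun t =>
      continuous_translation hα hfc hC continuous_id continuous_const
    exact continuous_of_dominated (bound := fun t => ‖φ t‖ * C)
      (fun x => hφ.aestronglyMeasurable.mul (h1 x).aestronglyMeasurable)
      (fun x => Eventually.of_forall (hbd x)) (hφ.norm.mul_const C)
      (Eventually.of_forall fun t => continuous_const.mul (h2 t))
  have hbdd : ∀ x, ‖∫ t, f t * translation α x φ t ∂(mu α)‖ ≤ ∫ t, ‖φ t‖ * C ∂(mu α) := fun x => by
    rw [e]
    exact norm_integral_le_of_norm_le (hφ.norm.mul_const C) (Eventually.of_forall (hbd x))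
  have hint : Integrable (fun x => ∫ t, f t * translation α x φ t ∂(mu α)) (mu α) :=
    (integrable_mul_translation hα hfc.measurable hf hφm hφ).integral_prod_left
  rw [← lintegral_hankel_sq hα hcont hbdd hint]
  simp only [hankel_convolution hα hfc.measurable hf hφm hφ, enorm_mul, mul_pow]

/-! ### The wavelet transform is an isometry -/

/-- The scale part `a ^ (2α+1) da` of the measure `nu α`. -/
def scaleMeasure (α : ℝ) : Measure ℝ :=
  (volume.restrict (Ioi (0 : ℝ))).withDensity (fun a => ENNReal.ofReal (a ^ (2 * α + 1)))

lemma nu_eq (α : ℝ) : nu α = (scaleMeasure α).prod (mu α) := rfl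

instance (α : ℝ) : SFinite (scaleMeasure α) := by unfold scaleMeasure; infer_instance

lemma lintegral_scaleMeasure (α : ℝ) (F : ℝ → ℝ≥0∞) :
    ∫⁻ a, F a ∂(scaleMeasure α) =
      ∫⁻ a in Ioi (0 : ℝ), ENNReal.ofReal (a ^ (2 * α + 1)) * F a := by
  unfold scaleMeasure
  rw [lintegral_withDensity_eq_lintegral_mul_non_measurable _ (by fun_prop)
    (Eventually.of_forall fun _ => ENNReal.ofReal_lt_top)]
  rfl

lemma ae_scaleMeasure_pos (α : ℝ) : ∀ᵐ a ∂(scaleMeasure α), 0 < a :=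
  (withDensity_absolutelyContinuous _ _).ae_le (ae_restrict_mem measurableSet_Ioi)

lemma ae_nu_pos (α : ℝ) : ∀ᵐ p ∂(nu α), 0 < p.1 ∧ 0 < p.2 := by
  rw [nu_eq]
  exact (Measure.quasiMeasurePreserving_fst.ae (ae_scaleMeasure_pos α)).and
    (Measure.quasiMeasurePreserving_snd.ae (ae_mu_pos α))

lemma isLocallyFiniteMeasure_mu {α : ℝ} (hα : -(1 / 2) < α) :
    IsLocallyFiniteMeasure (mu α) :=
  IsLocallyFiniteMeasure.withDensity_ofReal
    ((Real.continuous_rpow_const (by linarith)).div_const _)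

/-- The normalising factor `c_ψ ^ (-1/2)` of the wavelet atoms. -/
def atomConst (α : ℝ) (ψ : ℝ → ℂ) : ℝ := (admConst α ψ).toReal ^ (-(1 / 2) : ℝ)

lemma enorm_atomConst_sq {α : ℝ} {ψ : ℝ → ℂ} (h : IsAdmissible α ψ) :
    ‖(atomConst α ψ : ℂ)‖ₑ ^ 2 = (admConst α ψ)⁻¹ := by
  have hpos := ENNReal.toReal_pos h.admConst_pos.ne' h.admConst_lt_top.ne
  unfold atomConst
  rw [← ofReal_norm, Complex.norm_real, Real.norm_of_nonneg (by positivity),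
    ← ENNReal.ofReal_pow (by positivity), ← Real.rpow_mul_natCast hpos.le]
  norm_num
  rw [Real.rpow_neg_one, ENNReal.ofReal_inv_of_pos hpos, ENNReal.ofReal_toReal h.admConst_lt_top.ne]

lemma conj_translation {α : ℝ} (hα : -(1 / 2) < α) (x : ℝ) (f : ℝ → ℂ) (y : ℝ) :
    starRingEnd ℂ (translation α x f y) =
      translation α x (fun y => starRingEnd ℂ (f y)) y := by
  rw [translation_eq hα, translation_eq hα, integral_conj]

lemma conj_dilation (α a : ℝ) (f : ℝ → ℂ) :
    (fun y => starRingEnd ℂ (dilation α a f y)) =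
      dilation α a (fun y => starRingEnd ℂ (f y)) := by
  ext y; simp [dilation]

lemma conj_atom {α : ℝ} (hα : -(1 / 2) < α) (ψ : ℝ → ℂ) (a x t : ℝ) :
    starRingEnd ℂ (atom α ψ a x t) =
      atomConst α ψ * translation α x (dilation α a (fun y => starRingEnd ℂ (ψ y))) t := by
  rw [atom, map_mul, Complex.conj_ofReal, conj_translation hα, conj_dilation]
  rfl

lemma transform_eq {α : ℝ} (hα : -(1 / 2) < α) (ψ f : ℝ → ℂ) (p : ℝ × ℝ) :
    transform α ψ f p = atomConst α ψ *
      ∫ t, f t * translation α p.2 (dilation α p.1 (fun y => starRingEnd ℂ (ψ y))) t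
        ∂(mu α) := by
  simp only [transform, conj_atom hα, mul_left_comm _ (atomConst α ψ : ℂ)]
  rw [integral_const_mul]

lemma measurable_atom {α : ℝ} (hα : -(1 / 2) < α) {ψ : ℝ → ℂ} (hψ : Measurable ψ) :
    Measurable fun q : (ℝ × ℝ) × ℝ => atom α ψ q.1.1 q.1.2 q.2 := by
  unfold atom
  refine Measurable.const_mul ?_ _
  refine measurable_translation hα (f := fun q : (ℝ × ℝ) × ℝ => dilation α q.1.1 ψ) ?_
    (by fun_prop) (by fun_prop)
  unfold dilation
  fun_prop

lemma measurable_transform {α : ℝ} (hα : -(1 / 2) < α) {ψ f : ℝ → ℂ} (hψ : Measurable ψ)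
    (hf : AEStronglyMeasurable f (mu α)) : Measurable (transform α ψ f) := by
  have e : transform α ψ f = transform α ψ (hf.mk f) := by
    ext p
    refine integral_congr_ae ?_
    filter_upwards [hf.ae_eq_mk] with t ht
    rw [ht]
  rw [e]
  refine (StronglyMeasurable.integral_prod_right' (f := fun q : (ℝ × ℝ) × ℝ =>
    hf.mk f q.2 * starRingEnd ℂ (atom α ψ q.1.1 q.1.2 q.2)) ?_).measurable
  exact ((hf.stronglyMeasurable_mk.measurable.comp measurable_snd).mul
    (Complex.continuous_conj.measurable.comp (measurable_atom hα hψ))).stronglyMeasurable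

lemma eLpNorm_atom_le {α : ℝ} (hα : -(1 / 2) < α) {ψ : ℝ → ℂ} (hψ : Measurable ψ) {a : ℝ}
    (ha : 0 < a) (x : ℝ) :
    eLpNorm (atom α ψ a x) 2 (mu α) ≤ ‖(atomConst α ψ : ℂ)‖ₑ * eLpNorm ψ 2 (mu α) := by
  have e : atom α ψ a x = (atomConst α ψ : ℂ) • translation α x (dilation α a ψ) := rfl
  rw [e, eLpNorm_const_smul, ← eLpNorm_dilation hα ha ψ]
  gcongr
  exact eLpNorm_translation_le hα x (by unfold dilation; fun_prop)

lemma aestronglyMeasurable_conj_atom {α : ℝ} (hα : -(1 / 2) < α) {ψ : ℝ → ℂ} (hψ : Measurable ψ)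
    (a x : ℝ) : AEStronglyMeasurable (fun t => starRingEnd ℂ (atom α ψ a x t)) (mu α) :=
  (Complex.continuous_conj.measurable.comp ((measurable_atom hα hψ).comp
    (measurable_const.prodMk measurable_id : Measurable fun t : ℝ => ((a, x), t)))
    ).aestronglyMeasurable

lemma eLpNorm_conj_atom (α : ℝ) (ψ : ℝ → ℂ) (a x : ℝ) :
    eLpNorm (fun t => starRingEnd ℂ (atom α ψ a x t)) 2 (mu α) = eLpNorm (atom α ψ a x) 2 (mu α) :=
  eLpNorm_congr_norm_ae (Eventually.of_forall fun _ => RCLike.norm_conj _)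

/-- The pointwise bound `|W_ψ f| ≤ c_ψ ^ (-1/2) ‖ψ‖ ‖f‖`. -/
lemma enorm_transform_le {α : ℝ} (hα : -(1 / 2) < α) {ψ f : ℝ → ℂ} (hψ : Measurable ψ)
    (hf : AEStronglyMeasurable f (mu α)) {p : ℝ × ℝ} (hp : 0 < p.1) :
    ‖transform α ψ f p‖ₑ ≤
      eLpNorm f 2 (mu α) * (‖(atomConst α ψ : ℂ)‖ₑ * eLpNorm ψ 2 (mu α)) := by
  calc ‖transform α ψ f p‖ₑ
      ≤ ∫⁻ t, ‖(f • fun t => starRingEnd ℂ (atom α ψ p.1 p.2 t)) t‖ₑ ∂(mu α) :=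
        enorm_integral_le_lintegral_enorm _
    _ = eLpNorm (f • fun t => starRingEnd ℂ (atom α ψ p.1 p.2 t)) 1 (mu α) :=
        eLpNorm_one_eq_lintegral_enorm.symm
    _ ≤ eLpNorm f 2 (mu α) *
          eLpNorm (fun t => starRingEnd ℂ (atom α ψ p.1 p.2 t)) 2 (mu α) :=
        eLpNorm_smul_le_mul_eLpNorm (aestronglyMeasurable_conj_atom hα hψ _ _) hf
    _ ≤ _ := by
        rw [eLpNorm_conj_atom]
        gcongr
        exact eLpNorm_atom_le hα hψ hp _

lemma transform_sub {α : ℝ} (hα : -(1 / 2) < α) {ψ f g : ℝ → ℂ} (hψ : Measurable ψ)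
    (hψ2 : eLpNorm ψ 2 (mu α) < ∞) (hf : MemLp f 2 (mu α)) (hg : MemLp g 2 (mu α))
    {p : ℝ × ℝ} (hp : 0 < p.1) :
    transform α ψ (f - g) p = transform α ψ f p - transform α ψ g p := by
  have hm : MemLp (fun t => starRingEnd ℂ (atom α ψ p.1 p.2 t)) 2 (mu α) :=
    ⟨aestronglyMeasurable_conj_atom hα hψ _ _, by
      rw [eLpNorm_conj_atom]
      exact (eLpNorm_atom_le hα hψ hp _).trans_lt (ENNReal.mul_lt_top enorm_lt_top hψ2)⟩
  unfold transform
  refine Eq.trans ?_ (integral_sub (hf.integrable_mul hm) (hg.integrable_mul hm))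
  simp only [Pi.sub_apply, sub_mul]

/-- The admissibility integral is invariant under rescaling and inversion of the frequency. -/
lemma lintegral_hankel_div (α : ℝ) (ψ : ℝ → ℂ) {ξ : ℝ} (hξ : 0 < ξ) :
    ∫⁻ a in Ioi (0 : ℝ), ‖hankel α ψ (ξ / a)‖ₑ ^ 2 * ENNReal.ofReal (1 / a) = admConst α ψ := by
  have himg : (fun a => ξ / a) '' Ioi 0 = Ioi 0 := by
    ext y
    simp only [mem_image, mem_Ioi]
    exact ⟨fun ⟨x, hx, h⟩ => h ▸ div_pos hξ hx,
      fun hy => ⟨ξ / y, by positivity, by field_simp⟩⟩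
  have h := lintegral_image_eq_lintegral_abs_deriv_mul (s := Ioi (0 : ℝ)) measurableSet_Ioi
    (f := fun a => ξ / a) (f' := fun a => -ξ / a ^ 2)
    (fun a (ha : 0 < a) => by
      have := ((hasDerivAt_const a ξ).div (hasDerivAt_id a) ha.ne').hasDerivWithinAt
        (s := Ioi (0 : ℝ))
      convert! this using 1
      simp)
    (fun x (hx : 0 < x) y (hy : 0 < y) (h : ξ / x = ξ / y) => by
      field_simp at h; exact h.symm)
    (fun b => ‖hankel α ψ b‖ₑ ^ 2 * ENNReal.ofReal (1 / b))
  rw [himg] at h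
  rw [admConst, h]
  refine setLIntegral_congr_fun measurableSet_Ioi fun a (ha : 0 < a) => ?_
  rw [mul_left_comm, ← ENNReal.ofReal_mul (abs_nonneg _)]
  congr 2
  rw [abs_div, abs_neg, abs_of_pos hξ, abs_of_pos (by positivity)]
  field_simp

/-- The wavelet transform preserves the norm of bounded continuous integrable functions. -/
lemma lintegral_transform_sq {α : ℝ} (hα : -(1 / 2) < α) {ψ : ℝ → ℂ} (hψm : Measurable ψ)
    (hψ : IsAdmissible α ψ) {f : ℝ → ℂ} {C : ℝ} (hfc : Continuous f) (hC : ∀ y, ‖f y‖ ≤ C)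
    (hf : Integrable f (mu α)) :
    ∫⁻ p, ‖transform α ψ f p‖ₑ ^ 2 ∂(nu α) = ∫⁻ x, ‖f x‖ₑ ^ 2 ∂(mu α) := by
  have hψi : Integrable ψ (mu α) := memLp_one_iff_integrable.mp hψ.memLp_one
  set φ : ℝ → ℂ := fun y => starRingEnd ℂ (ψ y) with hφ
  have hφm : Measurable φ := Complex.continuous_conj.measurable.comp hψm
  have hφi : Integrable φ (mu α) :=
    hψi.congr' hφm.aestronglyMeasurable (Eventually.of_forall fun y => (RCLike.norm_conj _).symm)
  have hhf := (continuous_hankel hα hf).measurable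
  have hhψ := (continuous_hankel hα hψi).measurable
  have hWm := measurable_transform hα hψm hf.aestronglyMeasurable
  rw [nu_eq, lintegral_prod _ (hWm.enorm.pow_const 2).aemeasurable, lintegral_scaleMeasure]
  have e1 : ∀ a ∈ Ioi (0 : ℝ), ENNReal.ofReal (a ^ (2 * α + 1)) *
      ∫⁻ x, ‖transform α ψ f (a, x)‖ₑ ^ 2 ∂(mu α) =
      ∫⁻ ξ, (admConst α ψ)⁻¹ * ‖hankel α f ξ‖ₑ ^ 2 *
        (‖hankel α ψ (ξ / a)‖ₑ ^ 2 * ENNReal.ofReal (1 / a)) ∂(mu α) := by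
    intro a (ha : 0 < a)
    simp only [transform_eq hα, enorm_mul, mul_pow, enorm_atomConst_sq hψ]
    rw [lintegral_const_mul' _ _ (ENNReal.inv_ne_top.mpr hψ.admConst_pos.ne'),
      lintegral_convolution_sq hα hfc hC hf (by unfold dilation; fun_prop)
        (integrable_dilation hα ha hφi), ← mul_assoc, ← lintegral_const_mul' _ _
        (ENNReal.mul_ne_top ENNReal.ofReal_ne_top
          (ENNReal.inv_ne_top.mpr hψ.admConst_pos.ne'))]
    refine lintegral_congr fun ξ => ?_
    have e2 : ‖hankel α (dilation α a φ) ξ‖ₑ ^ 2 =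
        ENNReal.ofReal (a ^ (-(2 * α + 2))) * ‖hankel α ψ (ξ / a)‖ₑ ^ 2 := by
      rw [hankel_dilation hα ha, hφ, hankel_conj, enorm_mul, mul_pow, ← ofReal_norm,
        Complex.norm_real, Real.norm_of_nonneg (by positivity),
        ← ENNReal.ofReal_pow (by positivity), ← Real.rpow_mul_natCast ha.le]
      congr 2
      · congr 1; push_cast; ring
      · rw [← ofReal_norm, ← ofReal_norm, RCLike.norm_conj]
    have e3 : ENNReal.ofReal (1 / a) =
        ENNReal.ofReal (a ^ (2 * α + 1)) * ENNReal.ofReal (a ^ (-(2 * α + 2))) := by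
      rw [← ENNReal.ofReal_mul (by positivity), ← Real.rpow_add ha,
        show 2 * α + 1 + -(2 * α + 2) = -1 by ring, Real.rpow_neg_one, one_div]
    rw [e2, e3]
    ring
  rw [setLIntegral_congr_fun measurableSet_Ioi e1, lintegral_lintegral_swap (by
    refine Measurable.aemeasurable ?_
    have h1 : Measurable fun p : ℝ × ℝ => hankel α ψ (p.2 / p.1) :=
      hhψ.comp (measurable_snd.div measurable_fst)
    have h2 : Measurable fun p : ℝ × ℝ => hankel α f p.2 := hhf.comp measurable_snd
    simp only [Function.uncurry_def]
    fun_prop)]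
  rw [← lintegral_hankel_sq hα hfc hC hf]
  refine lintegral_congr_ae ?_
  filter_upwards [ae_mu_pos α] with ξ hξ
  rw [lintegral_const_mul' _ _ (ENNReal.mul_ne_top
    (ENNReal.inv_ne_top.mpr hψ.admConst_pos.ne') (by simp)), lintegral_hankel_div α ψ hξ,
    mul_right_comm, ENNReal.inv_mul_cancel hψ.admConst_pos.ne' hψ.admConst_lt_top.ne, one_mul]

lemma eLpNorm_transform_of_hasCompactSupport {α : ℝ} (hα : -(1 / 2) < α) {ψ : ℝ → ℂ}
    (hψm : Measurable ψ) (hψ : IsAdmissible α ψ) {f : ℝ → ℂ} (hfc : Continuous f)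
    (hf : HasCompactSupport f) :
    eLpNorm (transform α ψ f) 2 (nu α) = eLpNorm f 2 (mu α) := by
  have := isLocallyFiniteMeasure_mu hα
  obtain ⟨C, hC⟩ := hf.exists_bound_of_continuous hfc
  refine (ENNReal.pow_right_strictMono two_ne_zero).injective ?_
  simp only [eLpNorm_two_sq]
  exact lintegral_transform_sq hα hψm hψ hfc hC (hfc.integrable_of_hasCompactSupport hf)

/-- The half of the Plancherel formula of the wavelet transform that bounds `W_ψ f` by `f`. Density
and the pointwise bound give pointwise convergence of transforms, and Fatou's lemma the estimate. -/
lemma eLpNorm_transform_le {α : ℝ} (hα : -(1 / 2) < α) {ψ : ℝ → ℂ}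
    (hψm : Measurable ψ) (hψ : IsAdmissible α ψ) (hψ2 : eLpNorm ψ 2 (mu α) < ∞) {f : ℝ → ℂ}
    (hf : MemLp f 2 (mu α)) :
    eLpNorm (transform α ψ f) 2 (nu α) ≤ eLpNorm f 2 (mu α) := by
  have := isLocallyFiniteMeasure_mu hα
  have hδ : ∀ n : ℕ, ((n : ℝ≥0∞) + 1)⁻¹ ≠ 0 := fun n => by simp
  choose g hgs hgd hgc hg using fun n : ℕ =>
    hf.exists_hasCompactSupport_eLpNorm_sub_le (by norm_num) (hδ n)
  have hlim0 : Tendsto (fun n : ℕ => ((n : ℝ≥0∞) + 1)⁻¹) atTop (𝓝 0) := by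
    have := (tendsto_add_atTop_iff_nat 1).mpr ENNReal.tendsto_inv_nat_nhds_zero
    simpa using this
  have hptw : ∀ᵐ p ∂(nu α), Tendsto (fun n => transform α ψ (g n) p) atTop
      (𝓝 (transform α ψ f p)) := by
    filter_upwards [ae_nu_pos α] with p hp
    rw [tendsto_iff_edist_tendsto_0]
    have hb : ∀ n, edist (transform α ψ (g n) p) (transform α ψ f p) ≤
        ((n : ℝ≥0∞) + 1)⁻¹ * (‖(atomConst α ψ : ℂ)‖ₑ * eLpNorm ψ 2 (mu α)) := by
      intro n
      rw [edist_comm, edist_eq_enorm_sub, ← transform_sub hα hψm hψ2 hf (hg n) hp.1]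
      refine (enorm_transform_le hα hψm (hf.sub (hg n)).1 hp.1).trans ?_
      gcongr
      exact hgd n
    refine tendsto_of_tendsto_of_tendsto_of_le_of_le tendsto_const_nhds ?_ (fun _ => zero_le) hb
    have := ENNReal.Tendsto.mul_const (b := ‖(atomConst α ψ : ℂ)‖ₑ * eLpNorm ψ 2 (mu α)) hlim0
      (Or.inr (ENNReal.mul_ne_top enorm_ne_top hψ2.ne))
    simpa using this
  refine (Lp.eLpNorm_lim_le_liminf_eLpNorm
    (fun n => (measurable_transform hα hψm (hg n).1).aestronglyMeasurable) _ hptw).trans ?_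
  have hle : ∀ n, eLpNorm (transform α ψ (g n)) 2 (nu α) ≤
      eLpNorm f 2 (mu α) + ((n : ℝ≥0∞) + 1)⁻¹ := by
    intro n
    rw [eLpNorm_transform_of_hasCompactSupport hα hψm hψ (hgc n) (hgs n)]
    calc eLpNorm (g n) 2 (mu α) = eLpNorm (f - (f - g n)) 2 (mu α) := by rw [sub_sub_cancel]
      _ ≤ eLpNorm f 2 (mu α) + eLpNorm (f - g n) 2 (mu α) :=
        eLpNorm_sub_le hf.1 (hf.sub (hg n)).1 (by norm_num)
      _ ≤ _ := by gcongr; exact hgd n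
  refine (liminf_le_liminf (Eventually.of_forall hle)).trans (le_of_eq ?_)
  have := (tendsto_const_nhds (x := eLpNorm f 2 (mu α))).add hlim0
  rw [add_zero] at this
  exact this.liminf_eq

/-- The half of the Plancherel formula of the wavelet transform that bounds `f` by `W_ψ f`. -/
lemma eLpNorm_le_eLpNorm_transform {α : ℝ} (hα : -(1 / 2) < α) {ψ : ℝ → ℂ}
    (hψm : Measurable ψ) (hψ : IsAdmissible α ψ) (hψ2 : eLpNorm ψ 2 (mu α) < ∞) {f : ℝ → ℂ}
    (hf : MemLp f 2 (mu α)) :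
    eLpNorm f 2 (mu α) ≤ eLpNorm (transform α ψ f) 2 (nu α) := by
  have := isLocallyFiniteMeasure_mu hα
  refine ENNReal.le_of_forall_pos_le_add fun ε hε _ => ?_
  obtain ⟨g, hgs, hgd, hgc, hg⟩ := hf.exists_hasCompactSupport_eLpNorm_sub_le (by norm_num)
    (ε := (ε / 2 : NNReal)) (by simpa using hε.ne')
  have hWf := (measurable_transform hα hψm hf.1).aestronglyMeasurable (μ := nu α)
  have hWd := (measurable_transform hα hψm (hf.sub hg).1).aestronglyMeasurable (μ := nu α)
  have hsub : transform α ψ g =ᵐ[nu α] transform α ψ f - transform α ψ (f - g) := by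
    filter_upwards [ae_nu_pos α] with p hp
    rw [Pi.sub_apply, transform_sub hα hψm hψ2 hf hg hp.1, sub_sub_cancel]
  calc eLpNorm f 2 (mu α) = eLpNorm (g + (f - g)) 2 (mu α) := by rw [add_sub_cancel]
    _ ≤ eLpNorm g 2 (mu α) + eLpNorm (f - g) 2 (mu α) :=
      eLpNorm_add_le hg.1 (hf.sub hg).1 (by norm_num)
    _ = eLpNorm (transform α ψ f - transform α ψ (f - g)) 2 (nu α) + eLpNorm (f - g) 2 (mu α) := by
      rw [← eLpNorm_transform_of_hasCompactSupport hα hψm hψ hgc hgs, eLpNorm_congr_ae hsub]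
    _ ≤ eLpNorm (transform α ψ f) 2 (nu α) + eLpNorm (transform α ψ (f - g)) 2 (nu α) +
        eLpNorm (f - g) 2 (mu α) := by
      gcongr
      exact eLpNorm_sub_le hWf hWd (by norm_num)
    _ ≤ eLpNorm (transform α ψ f) 2 (nu α) + (ε / 2 : NNReal) + (ε / 2 : NNReal) := by
      gcongr
      exact (eLpNorm_transform_le hα hψm hψ hψ2 (hf.sub hg)).trans hgd
    _ = eLpNorm (transform α ψ f) 2 (nu α) + ε := by
      rw [add_assoc, ← ENNReal.coe_add, add_halves]

/-! ### The Gibbs weight and the uncertainty inequality -/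

lemma lintegral_scaleMeasure_exp {α s t : ℝ} (hα : -(1 / 2) < α) (hs : 0 < s) (ht : 0 < t) :
    ∫⁻ a, ENNReal.ofReal (Real.exp (-t⁻¹ * a ^ (2 * s))) ∂(scaleMeasure α) =
      ENNReal.ofReal (t ^ ((α + 1) / s) * (1 / (2 * s)) * Real.Gamma ((α + 1) / s)) := by
  rw [lintegral_scaleMeasure]
  have : ∀ x ∈ Ioi (0 : ℝ), ENNReal.ofReal (x ^ (2 * α + 1)) *
      ENNReal.ofReal (Real.exp (-t⁻¹ * x ^ (2 * s))) =
      ENNReal.ofReal (x ^ (2 * α + 1) * Real.exp (-t⁻¹ * x ^ (2 * s))) := by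
    intro x (hx : 0 < x)
    rw [← ENNReal.ofReal_mul (by positivity)]
  rw [setLIntegral_congr_fun measurableSet_Ioi this,
    lintegral_rpow_mul_exp (by positivity) (by linarith) (by positivity),
    show -(2 * α + 1 + 1) / (2 * s) = -((α + 1) / s) by field_simp; ring,
    show (2 * α + 1 + 1) / (2 * s) = (α + 1) / s by field_simp; ring,
    Real.inv_rpow ht.le, Real.rpow_neg ht.le, inv_inv]

lemma lintegral_mu_exp {α β t : ℝ} (hα : -(1 / 2) < α) (hβ : 0 < β) (ht : 0 < t) :
    ∫⁻ x, ENNReal.ofReal (Real.exp (-t⁻¹ * x ^ (2 * β))) ∂(mu α) =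
      ENNReal.ofReal (t ^ ((α + 1) / β) * (1 / (2 * β)) * Real.Gamma ((α + 1) / β) /
        (2 ^ α * Real.Gamma (α + 1))) := by
  have hn := norm_const_pos hα
  have e := lintegral_scaleMeasure_exp hα hβ ht
  rw [div_eq_inv_mul, ENNReal.ofReal_mul (by positivity), ← e, lintegral_scaleMeasure, lintegral_mu,
    ← lintegral_const_mul' _ _ ENNReal.ofReal_ne_top]
  refine setLIntegral_congr_fun measurableSet_Ioi fun x (hx : 0 < x) => ?_
  rw [← mul_assoc, ← ENNReal.ofReal_mul (inv_nonneg.mpr hn.le), div_eq_inv_mul]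

/-- The partition function of the weight `exp (-(a ^ (2s) + x ^ (2β)) / t)`. -/
lemma lintegral_nu_exp {α s β t : ℝ} (hα : -(1 / 2) < α) (hs : 0 < s) (hβ : 0 < β) (ht : 0 < t) :
    ∫⁻ p, ENNReal.ofReal (Real.exp (-t⁻¹ * (p.1 ^ (2 * s) + p.2 ^ (2 * β)))) ∂(nu α) =
      ENNReal.ofReal (t ^ ((α + 1) * (s + β) / (s * β)) *
        (Real.Gamma ((α + 1) / s) * Real.Gamma ((α + 1) / β) /
          (2 ^ (α + 2) * s * β * Real.Gamma (α + 1)))) := by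
  have hα1 : 0 < α + 1 := by linarith
  have hG1 := Real.Gamma_pos_of_pos (div_pos hα1 hs)
  have hG2 := Real.Gamma_pos_of_pos (div_pos hα1 hβ)
  have hG := Real.Gamma_pos_of_pos hα1
  have e : ∀ p : ℝ × ℝ, ENNReal.ofReal (Real.exp (-t⁻¹ * (p.1 ^ (2 * s) + p.2 ^ (2 * β)))) =
      ENNReal.ofReal (Real.exp (-t⁻¹ * p.1 ^ (2 * s))) *
        ENNReal.ofReal (Real.exp (-t⁻¹ * p.2 ^ (2 * β))) := fun p => by
    rw [mul_add, Real.exp_add, ENNReal.ofReal_mul (Real.exp_pos _).le]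
  rw [lintegral_congr e, nu_eq, lintegral_prod_mul
    (f := fun a : ℝ => ENNReal.ofReal (Real.exp (-t⁻¹ * a ^ (2 * s))))
    (g := fun x : ℝ => ENNReal.ofReal (Real.exp (-t⁻¹ * x ^ (2 * β)))) (by fun_prop) (by fun_prop),
    lintegral_scaleMeasure_exp hα hs ht, lintegral_mu_exp hα hβ ht,
    ← ENNReal.ofReal_mul (by positivity)]
  congr 1
  rw [show (α + 1) * (s + β) / (s * β) = (α + 1) / s + (α + 1) / β by field_simp; ring,
    Real.rpow_add ht, Real.rpow_add two_pos, Real.rpow_two]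
  field_simp

/-- The Gibbs variational inequality in pointwise form: multiply `1 + v ≤ exp v`, at
`v = κ - u`, by a density `w` bounded by `M`. The number `u` stands for the energy `φ / t`. -/
lemma gibbs_pointwise {w M κ u : ℝ} (hw : 0 ≤ w) (hM : w ≤ M) :
    (1 + κ) * w ≤ w * u + M * Real.exp κ * Real.exp (-u) := by
  have h1 := Real.add_one_le_exp (κ - u)
  have h2 : w * (κ - u + 1) ≤ M * Real.exp (κ - u) :=
    (mul_le_mul_of_nonneg_left h1 hw).trans (by gcongr)
  rw [mul_assoc, ← Real.exp_add, ← sub_eq_add_neg]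
  linarith

lemma lintegral_enorm_weight_sq {α r : ℝ} (π : ℝ × ℝ → ℝ) (hπ : ∀ᵐ p ∂(nu α), 0 < π p)
    (W : ℝ × ℝ → ℂ) :
    eLpNorm (fun p => ((π p ^ r : ℝ) : ℂ) * W p) 2 (nu α) ^ 2 =
      ∫⁻ p, ENNReal.ofReal (π p ^ (2 * r)) * ‖W p‖ₑ ^ 2 ∂(nu α) := by
  rw [eLpNorm_two_sq]
  refine lintegral_congr_ae ?_
  filter_upwards [hπ] with p hp
  rw [enorm_mul, mul_pow, ← ofReal_norm, Complex.norm_real, Real.norm_of_nonneg (by positivity),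
    ← ENNReal.ofReal_pow (by positivity), ← Real.rpow_mul_natCast hp.le]
  congr 3
  push_cast; ring

/-- Uncertainty for a bounded density: if `∫ |W|² dν ≥ N`, `|W|² ≤ M N` and the weight
`M e^κ exp (-φ / t)` has total mass one, then `∫ φ |W|² dν ≥ κ t N`. -/
lemma le_lintegral_weight_of_bound {X : Type*} [MeasurableSpace X] {ν : Measure X}
    {W : X → ℂ} {φ : X → ℝ} {N : ℝ≥0∞} {M κ t : ℝ} (hφ : Measurable φ)
    (hφ0 : ∀ᵐ p ∂ν, 0 ≤ φ p) (hN : N ≠ ∞) (hM : 0 ≤ M) (hκ : 0 ≤ κ) (ht : 0 < t)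
    (hlow : N ≤ ∫⁻ p, ‖W p‖ₑ ^ 2 ∂ν) (hup : ∀ᵐ p ∂ν, ‖W p‖ₑ ^ 2 ≤ ENNReal.ofReal M * N)
    (hZ : ENNReal.ofReal (M * Real.exp κ) *
      ∫⁻ p, ENNReal.ofReal (Real.exp (-t⁻¹ * φ p)) ∂ν = 1) :
    ENNReal.ofReal (κ * t) * N ≤ ∫⁻ p, ENNReal.ofReal (φ p) * ‖W p‖ₑ ^ 2 ∂ν := by
  have hpt : ∀ᵐ p ∂ν, ENNReal.ofReal (1 + κ) * ‖W p‖ₑ ^ 2 ≤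
      ENNReal.ofReal t⁻¹ * (ENNReal.ofReal (φ p) * ‖W p‖ₑ ^ 2) +
      N * (ENNReal.ofReal (M * Real.exp κ) * ENNReal.ofReal (Real.exp (-t⁻¹ * φ p))) := by
    filter_upwards [hφ0, hup] with p h0 hp
    lift N to NNReal using hN
    have e1 : ‖W p‖ₑ ^ 2 = ENNReal.ofReal (‖W p‖ ^ 2) := by
      rw [← ofReal_norm, ENNReal.ofReal_pow (norm_nonneg _)]
    have e2 : (N : ℝ≥0∞) = ENNReal.ofReal N := by simp
    rw [e1, e2, ← ENNReal.ofReal_mul hM, ENNReal.ofReal_le_ofReal_iff (by positivity)] at hp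
    have h := gibbs_pointwise (κ := κ) (u := t⁻¹ * φ p) (sq_nonneg ‖W p‖) hp
    have hti : 0 ≤ t⁻¹ := by positivity
    rw [e1, e2, ← ENNReal.ofReal_mul (by positivity), ← ENNReal.ofReal_mul h0,
      ← ENNReal.ofReal_mul hti, ← ENNReal.ofReal_mul (by positivity),
      ← ENNReal.ofReal_mul (by positivity), ← ENNReal.ofReal_add (by positivity) (by positivity)]
    refine ENNReal.ofReal_le_ofReal (h.trans (le_of_eq ?_))
    rw [neg_mul]
    ring
  have hint := lintegral_mono_ae hpt
  rw [lintegral_add_right _ (by fun_prop), lintegral_const_mul' _ _ ENNReal.ofReal_ne_top,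
    lintegral_const_mul' _ _ ENNReal.ofReal_ne_top, lintegral_const_mul' _ _ hN,
    lintegral_const_mul' _ _ ENNReal.ofReal_ne_top, hZ, mul_one] at hint
  have h1 : ENNReal.ofReal κ * N + N ≤
      ENNReal.ofReal t⁻¹ * ∫⁻ p, ENNReal.ofReal (φ p) * ‖W p‖ₑ ^ 2 ∂ν + N := by
    refine le_trans (le_of_eq ?_) ((mul_le_mul_right hlow (ENNReal.ofReal (1 + κ))).trans hint)
    rw [ENNReal.ofReal_add zero_le_one hκ, ENNReal.ofReal_one]; ring
  have h2 := (ENNReal.add_le_add_iff_right hN).mp h1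
  calc ENNReal.ofReal (κ * t) * N = ENNReal.ofReal t * (ENNReal.ofReal κ * N) := by
        rw [mul_comm κ, ENNReal.ofReal_mul ht.le, mul_assoc]
    _ ≤ ENNReal.ofReal t * (ENNReal.ofReal t⁻¹ *
          ∫⁻ p, ENNReal.ofReal (φ p) * ‖W p‖ₑ ^ 2 ∂ν) := by gcongr
    _ = _ := by
        rw [← mul_assoc, ← ENNReal.ofReal_mul ht.le, mul_inv_cancel₀ ht.ne', ENNReal.ofReal_one,
          one_mul]

lemma admConst_congr_ae {α : ℝ} {ψ ψ' : ℝ → ℂ} (h : ψ =ᵐ[mu α] ψ') :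
    admConst α ψ = admConst α ψ' := by
  unfold admConst; rw [hankel_congr_ae h]

lemma IsAdmissible.congr_ae {α : ℝ} {ψ ψ' : ℝ → ℂ} (hψ : IsAdmissible α ψ)
    (h : ψ =ᵐ[mu α] ψ') : IsAdmissible α ψ' where
  memLp_one := hψ.memLp_one.ae_eq h
  memLp_top := hψ.memLp_top.ae_eq h
  nonzero := fun h' => hψ.nonzero (h.trans h')
  admConst_pos := admConst_congr_ae h ▸ hψ.admConst_pos
  admConst_lt_top := admConst_congr_ae h ▸ hψ.admConst_lt_top

lemma transform_congr_ae {α : ℝ} (hα : -(1 / 2) < α) {ψ ψ' : ℝ → ℂ} (h : ψ =ᵐ[mu α] ψ')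
    (f : ℝ → ℂ) : transform α ψ f =ᵐ[nu α] transform α ψ' f := by
  filter_upwards [ae_nu_pos α] with p hp
  refine integral_congr_ae ?_
  filter_upwards [translation_congr_ae hα p.2 (dilation_congr_ae hα hp.1 h)] with t ht
  rw [atom, atom, ht, admConst_congr_ae h]

lemma heisConst_congr_ae {α : ℝ} (s β : ℝ) {ψ ψ' : ℝ → ℂ} (h : ψ =ᵐ[mu α] ψ') :
    heisConst s α β ψ = heisConst s α β ψ' := by
  unfold heisConst; rw [admConst_congr_ae h, eLpNorm_congr_ae h]

lemma heisConst_pos {α s β : ℝ} (hα : -(1 / 2) < α) (hs : 0 < s) (hβ : 0 < β) (ψ : ℝ → ℂ) :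
    0 < heisConst s α β ψ :=
  mul_pos (div_pos (mul_pos (by linarith) (by linarith)) (by positivity)) (Real.exp_pos _)

lemma heisenberg_of_measurable {α s β : ℝ} (hα : -(1 / 2) < α) (hs : 0 < s) (hβ : 0 < β)
    {ψ : ℝ → ℂ} (hψm : Measurable ψ) (hψ : IsAdmissible α ψ) (hψ2 : eLpNorm ψ 2 (mu α) < ∞)
    {f : ℝ → ℂ} (hf : MemLp f 2 (mu α)) :
    ENNReal.ofReal (heisConst s α β ψ) * eLpNorm f 2 (mu α) ^ 2 ≤
      eLpNorm (fun p : ℝ × ℝ => ((p.1 ^ s : ℝ) : ℂ) * transform α ψ f p) 2 (nu α) ^ 2 +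
      eLpNorm (fun p : ℝ × ℝ => ((p.2 ^ β : ℝ) : ℂ) * transform α ψ f p) 2 (nu α) ^ 2 := by
  have hα1 : 0 < α + 1 := by linarith
  have hG1 := Real.Gamma_pos_of_pos (div_pos hα1 hs)
  have hG2 := Real.Gamma_pos_of_pos (div_pos hα1 hβ)
  have hG := Real.Gamma_pos_of_pos hα1
  have hc := ENNReal.toReal_pos hψ.admConst_pos.ne' hψ.admConst_lt_top.ne
  have hb0 : eLpNorm ψ 2 (mu α) ≠ 0 := fun h =>
    hψ.nonzero ((eLpNorm_eq_zero_iff hψm.aestronglyMeasurable (by norm_num)).mp h)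
  have hb := ENNReal.toReal_pos hb0 hψ2.ne
  have hM : ENNReal.ofReal ((eLpNorm ψ 2 (mu α)).toReal ^ 2 / (admConst α ψ).toReal) =
      (admConst α ψ)⁻¹ * eLpNorm ψ 2 (mu α) ^ 2 := by
    rw [ENNReal.ofReal_div_of_pos hc, ENNReal.ofReal_pow hb.le, ENNReal.ofReal_toReal hψ2.ne,
      ENNReal.ofReal_toReal hψ.admConst_lt_top.ne, div_eq_mul_inv, mul_comm]
  have hup : ∀ᵐ p ∂(nu α), ‖transform α ψ f p‖ₑ ^ 2 ≤ ENNReal.ofReal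
      ((eLpNorm ψ 2 (mu α)).toReal ^ 2 / (admConst α ψ).toReal) * eLpNorm f 2 (mu α) ^ 2 := by
    filter_upwards [ae_nu_pos α] with p hp
    rw [hM, mul_comm, ← enorm_atomConst_sq hψ, ← mul_pow, ← mul_pow]
    gcongr
    exact enorm_transform_le hα hψm hf.1 hp.1
  have hlow : eLpNorm f 2 (mu α) ^ 2 ≤ ∫⁻ p, ‖transform α ψ f p‖ₑ ^ 2 ∂(nu α) := by
    rw [← eLpNorm_two_sq]
    gcongr
    exact eLpNorm_le_eLpNorm_transform hα hψm hψ hψ2 hf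
  have hWm := measurable_transform hα hψm hf.1
  have hC : heisConst s α β ψ = (α + 1) * (s + β) / (s * β) *
    Real.exp (-1 + s * β / ((α + 1) * (s + β)) * Real.log
        (2 ^ (α + 2) * s * β * Real.Gamma (α + 1) /
            (Real.Gamma ((α + 1) / s) * Real.Gamma ((α + 1) / β)) *
          ((admConst α ψ).toReal / (eLpNorm ψ 2 (mu α)).toReal ^ 2))) := rfl
  generalize (admConst α ψ).toReal = c at *
  generalize (eLpNorm ψ 2 (mu α)).toReal = b at *
  set κ := (α + 1) * (s + β) / (s * β) with hκdef
  have hκ : 0 < κ := by positivity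
  set Q := 2 ^ (α + 2) * s * β * Real.Gamma (α + 1) /
    (Real.Gamma ((α + 1) / s) * Real.Gamma ((α + 1) / β)) * (c / b ^ 2) with hQdef
  have hQ : 0 < Q := by positivity
  -- this temperature maximises the lower bound given by the Gibbs inequality
  set t := Real.exp (-1 + s * β / ((α + 1) * (s + β)) * Real.log Q) with htdef
  have ht : 0 < t := Real.exp_pos _
  have htκ : t ^ κ = Real.exp (-κ) * Q := by
    rw [htdef, ← Real.exp_mul, ← Real.exp_log hQ, ← Real.exp_add, Real.log_exp]
    congr 1
    rw [hκdef]
    field_simp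
  have hZ : ENNReal.ofReal (b ^ 2 / c * Real.exp κ) * ∫⁻ p : ℝ × ℝ, ENNReal.ofReal
      (Real.exp (-t⁻¹ * (p.1 ^ (2 * s) + p.2 ^ (2 * β)))) ∂(nu α) = 1 := by
    rw [lintegral_nu_exp hα hs hβ ht, ← ENNReal.ofReal_mul (by positivity), htκ, Real.exp_neg,
      ← ENNReal.ofReal_one, hQdef]
    congr 1
    field_simp
  have hmain := le_lintegral_weight_of_bound (φ := fun p : ℝ × ℝ => p.1 ^ (2 * s) + p.2 ^ (2 * β))
    (by fun_prop) (by
      filter_upwards [ae_nu_pos α] with p hp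
      have h1 := hp.1
      have h2 := hp.2
      positivity) (ENNReal.pow_ne_top hf.2.ne) (by positivity) hκ.le ht hlow hup hZ
  rw [hC, lintegral_enorm_weight_sq Prod.fst ((ae_nu_pos α).mono fun p hp => hp.1),
    lintegral_enorm_weight_sq Prod.snd ((ae_nu_pos α).mono fun p hp => hp.2),
    ← lintegral_add_left (by fun_prop)]
  refine hmain.trans (le_of_eq (lintegral_congr_ae ?_))
  filter_upwards [ae_nu_pos α] with p hp
  have h1 := hp.1
  have h2 := hp.2
  rw [ENNReal.ofReal_add (by positivity) (by positivity), add_mul]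

end HankelWavelet

end

theorem mainTheorem6 (α s β : ℝ) (hα : -(1 / 2) < α) (hs : 0 < s) (hβ : 0 < β)
    (ψ : ℝ → ℂ) (hψ : HankelWavelet.IsAdmissible α ψ)
    (hψc : MeasureTheory.eLpNorm ψ 2 (HankelWavelet.mu α) ^ 2 ≤ HankelWavelet.admConst α ψ) :
    0 < HankelWavelet.heisConst s α β ψ ∧
      ∀ f : ℝ → ℂ, MeasureTheory.MemLp f 2 (HankelWavelet.mu α) →
        ¬ (f =ᵐ[HankelWavelet.mu α] 0) →
        ENNReal.ofReal (HankelWavelet.heisConst s α β ψ) *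
            MeasureTheory.eLpNorm f 2 (HankelWavelet.mu α) ^ 2 ≤
          MeasureTheory.eLpNorm
              (fun p : ℝ × ℝ => ((p.1 ^ s : ℝ) : ℂ) * HankelWavelet.transform α ψ f p)
              2 (HankelWavelet.nu α) ^ 2 +
            MeasureTheory.eLpNorm
              (fun p : ℝ × ℝ => ((p.2 ^ β : ℝ) : ℂ) * HankelWavelet.transform α ψ f p)
              2 (HankelWavelet.nu α) ^ 2 := by
  refine ⟨HankelWavelet.heisConst_pos hα hs hβ ψ, fun f hf _ => ?_⟩
  have hψ2 : MeasureTheory.eLpNorm ψ 2 (HankelWavelet.mu α) < ⊤ := by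
    by_contra h
    rw [not_lt, top_le_iff] at h
    rw [h, ENNReal.top_pow two_ne_zero] at hψc
    exact (hψc.trans_lt hψ.admConst_lt_top).ne rfl
  -- a Borel representative of the wavelet makes its transform jointly measurable
  obtain ⟨ψ', hψ'm, h⟩ := hψ.memLp_one.1
  have hW := HankelWavelet.transform_congr_ae hα h f
  have key := HankelWavelet.heisenberg_of_measurable hα hs hβ hψ'm.measurable (hψ.congr_ae h)
    (MeasureTheory.eLpNorm_congr_ae h ▸ hψ2) hf
  rw [← HankelWavelet.heisConst_congr_ae s β h] at key
  refine key.trans (le_of_eq ?_)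
  congr 2
  · exact MeasureTheory.eLpNorm_congr_ae (hW.mono fun p hp => by simp only [hp])
  · exact MeasureTheory.eLpNorm_congr_ae (hW.mono fun p hp => by simp only [hp])
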